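/- Let $\mathbf E,\mathbf B:\mathbb R\times\mathbb R^3\to\mathbb R^3$ be $C^1$ fields solving Maxwell's equations in free space (units $c=1$) on all of space-time, $$\partial_t\mathbf E=\nabla\times\mathbf B,\qquad \partial_t\mathbf B=-\nabla\times\mathbf E,\qquad \nabla\cdot\mathbf E=\nabla\cdot\mathbf B=0,$$ with initial data $\mathbf E|_{t=0}=\mathbf E_0$, $\mathbf B|_{t=0}=\mathbf B_0$ that are real-analytic vector fields on $\mathbb R^3$. Assume that the initial normalized Poynting field $\mathbf V_0=(\mathbf E_0\times\mathbf B_0)/W_0$, where $W_0=\tfrac12(\mathbf E_0\cdot\mathbf E_0+\mathbf B_0\cdot\mathbf B_0)$, is well defined and smooth everywhere, in the sense that $\mathbf V_0:\mathbb R^3\to\mathbb R^3$ is a $C^\infty$ vector field with $W_0\mathbf V_0=\mathbf E_0\times\mathbf B_0$ on $\mathbb R^3$ (at points where $W_0$ vanishes, $\mathbf V_0$ is thus a smooth extension of the quotient). Then the electromagnetic field is null on all of space-time, that is, $$\mathbf E\cdot\mathbf B=0\quad\text{and}\quad \mathbf E\cdot\mathbf E=\mathbf B\cdot\mathbf B\qquad\text{for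 all }(t,x)\in\mathbb R\times\mathbb R^3,$$ if and only if the initial data satisfy, everywhere on $\mathbb R^3$, 1. (divergence-free) $\nabla\cdot\mathbf E_0=\nabla\cdot\mathbf B_0=0$; 2. (null) $\mathbf E_0\cdot\mathbf B_0=0$ and $\mathbf E_0\cdot\mathbf E_0=\mathbf B_0\cdot\mathbf B_0$; 3. (shear-free) $\sum_{i,j}(E_0^iE_0^j-B_0^iB_0^j)\,\partial_jV_{0,i}=0$ and $\sum_{i,j}(E_0^iB_0^j+E_0^jB_0^i)\,\partial_jV_{0,i}=0$. -/

import Mathlib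

open scoped Matrix ContDiff

namespace Maxwell

/-- Points and vectors of `ℝ³`. Only the dot product `⬝ᵥ` and the cross product `⨯₃` are used on it;
no norm enters the statements. -/
abbrev Vec3 : Type := Fin 3 → ℝ

noncomputable section

/-- The partial derivative `∂_j X_i` of a vector field `X` on `ℝ³`. -/
def pderiv (X : Vec3 → Vec3) (j i : Fin 3) (x : Vec3) : ℝ :=
  fderiv ℝ X x (Pi.single j 1) i

/-- The divergence `∇ · X`. -/
def divergence (X : Vec3 → Vec3) (x : Vec3) : ℝ :=
  ∑ i, pderiv X i i x

/-- The curl `∇ × X`. -/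
def curl (X : Vec3 → Vec3) (x : Vec3) : Vec3 :=
  ![pderiv X 1 2 x - pderiv X 2 1 x,
    pderiv X 2 0 x - pderiv X 0 2 x,
    pderiv X 0 1 x - pderiv X 1 0 x]

/-- Classical (jointly `C¹`) solutions on all of space-time `ℝ × ℝ³` of Maxwell's equations in free
space, in units where `c = 1`. -/
structure IsMaxwellSolution (E B : ℝ → Vec3 → Vec3) : Prop where
  contDiff_E : ContDiff ℝ 1 (fun p : ℝ × Vec3 => E p.1 p.2)
  contDiff_B : ContDiff ℝ 1 (fun p : ℝ × Vec3 => B p.1 p.2)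
  ampere : ∀ t x, deriv (fun s => E s x) t = curl (B t) x
  faraday : ∀ t x, deriv (fun s => B s x) t = -curl (E t) x
  gauss_E : ∀ t x, divergence (E t) x = 0
  gauss_B : ∀ t x, divergence (B t) x = 0

/-- The energy density `W = (E · E + B · B) / 2`. -/
def energyDensity (E B : Vec3 → Vec3) (x : Vec3) : ℝ :=
  (E x ⬝ᵥ E x + B x ⬝ᵥ B x) / 2

/-- `V` is a normalized Poynting field `(E × B) / W` of `E`, `B`, defined and smooth on all of `ℝ³`.
The relation is written as `W V = E × B`, so that `V` is the quotient wherever `W ≠ 0`, while at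
zeros of `W` it is only required that `V` extends the quotient smoothly. -/
structure IsNormalizedPoynting (E B V : Vec3 → Vec3) : Prop where
  smooth : ContDiff ℝ ∞ V
  energyDensity_smul : ∀ x, energyDensity E B x • V x = E x ⨯₃ B x

/-- The null conditions `E · B = 0`, `E · E = B · B` everywhere on `ℝ³`. -/
def IsNull (E B : Vec3 → Vec3) : Prop :=
  ∀ x, E x ⬝ᵥ B x = 0 ∧ E x ⬝ᵥ E x = B x ⬝ᵥ B x

/-- The shear-free conditions `(EⁱEʲ - BⁱBʲ) ∂_j V_i = 0` and `(EⁱBʲ + EʲBⁱ) ∂_j V_i = 0`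
everywhere on `ℝ³`. -/
def IsShearFree (E B V : Vec3 → Vec3) : Prop :=
  ∀ x,
    ∑ i, ∑ j, (E x i * E x j - B x i * B x j) * pderiv V j i x = 0 ∧
    ∑ i, ∑ j, (E x i * B x j + E x j * B x i) * pderiv V j i x = 0

end

end Maxwell

/-! The complex field `F = E + i B` turns Maxwell's equations into `∂ₜ F = -i curl F`, `div F = 0`,
and the field is null exactly when `N = ∑ᵢ Fᵢ²` vanishes. Modulo `N` and its first derivatives,
`F_k² □ N` is zero, so `N` solves a homogeneous linear second order equation which is
noncharacteristic at `t = 0` wherever `F_k ≠ 0`. If `N` and `∂ₜ N` vanish at `t = 0`, then so do all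
its time derivatives, on an open set, and `N = 0` because `F` is analytic: analytic data are
propagated by Kirchhoff's formula with spherical means, and this solution is the given one by
conservation of energy. For null data the normalized Poynting field satisfies `V × E = B` and
`V × B = -E`, which turns the shear-free conditions into `F · curl F = 0`, that is, `∂ₜ N = 0`. -/

open MeasureTheory Set Filter Topology
open scoped ENNReal NNReal Pointwise

namespace Maxwell

noncomputable section

theorem fderiv_prodMk_right_apply {G H K : Type*} [NormedAddCommGroup G] [NormedSpace ℝ G]
    [NormedAddCommGroup H] [NormedSpace ℝ H] [NormedAddCommGroup K] [NormedSpace ℝ K]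
    {g : G × H → K} {a : G} {x : H} (hg : DifferentiableAt ℝ g (a, x)) (v : H) :
    fderiv ℝ (fun y => g (a, y)) x v = fderiv ℝ g (a, x) (0, v) :=
  congr($((hg.hasFDerivAt.comp x (hasFDerivAt_prodMk_right a x)).fderiv) v)

theorem deriv_prodMk_left {H K : Type*} [NormedAddCommGroup H] [NormedSpace ℝ H]
    [NormedAddCommGroup K] [NormedSpace ℝ K] {g : ℝ × H → K} {t : ℝ} {x : H}
    (hg : DifferentiableAt ℝ g (t, x)) : deriv (fun s => g (s, x)) t = fderiv ℝ g (t, x) (1, 0) :=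
  (hg.hasFDerivAt.comp_hasDerivAt t ((hasDerivAt_id t).prodMk (hasDerivAt_const t x))).deriv

theorem integrable_of_continuous {Y F : Type*} [TopologicalSpace Y] [T2Space Y]
    [MeasurableSpace Y] [BorelSpace Y] [NormedAddCommGroup F] {μ : Measure Y} [IsFiniteMeasure μ]
    {K : Set Y} (hK : IsCompact K) (hμ : ∀ᵐ y ∂μ, y ∈ K) {h : Y → F} (hh : Continuous h) :
    Integrable h μ := by
  have := hh.continuousOn.integrableOn_compact (μ := μ) hK
  rwa [IntegrableOn, Measure.restrict_eq_self_of_ae_mem hμ] at this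

section ParametricIntegral

variable {X Y F : Type*} [NormedAddCommGroup X] [NormedSpace ℝ X]
  [NormedAddCommGroup Y] [NormedSpace ℝ Y] [NormedAddCommGroup F] [NormedSpace ℝ F]

theorem analyticAt_integral_of_hasSum {Z : Type*} [MeasurableSpace Z]
    [CompleteSpace F] {ν : Measure Z} [IsFiniteMeasure ν] {f : Z → X → F}
    {q : Z → FormalMultilinearSeries ℝ X F} {b : ℕ → ℝ} {ρ : ℝ≥0} {x₀ : X} (hρ : 0 < ρ)
    (hf : ∀ᵐ z ∂ν, ∀ h : X, ‖h‖₊ < ρ → HasSum (fun n => q z n fun _ => h) (f z (x₀ + h)))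
    (hq : ∀ n, AEStronglyMeasurable (fun z => q z n) ν)
    (hqb : ∀ n, ∀ᵐ z ∂ν, ‖q z n‖ ≤ b n) (hb : Summable fun n => b n * (ρ : ℝ) ^ n) :
    AnalyticAt ℝ (fun x => ∫ z, f z x ∂ν) x₀ := by
  have hint (n : ℕ) : Integrable (fun z => q z n) ν := .of_bound (hq n) (b n) (hqb n)
  let Q : FormalMultilinearSeries ℝ X F := fun n => ∫ z, q z n ∂ν
  refine ⟨Q, ρ, ?_, by exact_mod_cast hρ, fun {h} hh => ?_⟩
  · refine Q.le_radius_of_summable_norm <|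
      Summable.of_nonneg_of_le (fun n => by positivity) (fun n => ?_) (hb.mul_right (ν.real univ))
    calc ‖Q n‖ * (ρ : ℝ) ^ n ≤ b n * ν.real univ * (ρ : ℝ) ^ n := by
          gcongr; exact norm_integral_le_of_norm_le_const (hqb n)
      _ = b n * (ρ : ℝ) ^ n * ν.real univ := by ring
  · have hh' : ‖h‖₊ < ρ := by simpa [enorm_eq_nnnorm] using! hh
    let ev (n : ℕ) := ContinuousMultilinearMap.apply ℝ (fun _ : Fin n => X) F fun _ => h
    have hQ (n : ℕ) : Q n (fun _ => h) = ∫ z, q z n (fun _ => h) ∂ν :=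
      ((ev n).integral_comp_comm (hint n)).symm
    simp_rw [hQ]
    refine hasSum_integral_of_dominated_convergence (fun n _ => b n * (ρ : ℝ) ^ n)
      (fun n => (ev n).continuous.comp_aestronglyMeasurable (hq n)) (fun n => ?_)
      (.of_forall fun _ => hb) (integrable_const _) (hf.mono fun z hz => hz h hh')
    filter_upwards [hqb n] with z hz
    calc ‖q z n fun _ => h‖ ≤ ‖q z n‖ * ‖h‖ ^ n := by simpa using (q z n).le_opNorm fun _ => h
      _ ≤ b n * (ρ : ℝ) ^ n := by
        have : ‖h‖ ≤ ρ := hh'.le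
        gcongr
        exact (norm_nonneg _).trans hz

theorem nnnorm_changeOrigin_le_tsum {p : FormalMultilinearSeries ℝ X F} {x : X} {ρ : ℝ≥0}
    (hx : ‖x‖₊ ≤ ρ) (hρ : (ρ : ℝ≥0∞) < p.radius) (n : ℕ) :
    ‖p.changeOrigin x n‖₊ ≤
      ∑' s : Σ l : ℕ, { s : Finset (Fin (n + l)) // s.card = l }, ‖p (n + s.1)‖₊ * ρ ^ s.1 := by
  have hsum := p.changeOriginSeries_summable_aux₂ hρ n
  have hle (s : Σ l : ℕ, { s : Finset (Fin (n + l)) // s.card = l }) :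
      ‖p (n + s.1)‖₊ * ‖x‖₊ ^ s.1 ≤ ‖p (n + s.1)‖₊ * ρ ^ s.1 := by
    gcongr
  exact (p.nnnorm_changeOrigin_le n ((ENNReal.coe_le_coe.2 hx).trans_lt hρ)).trans
    ((NNReal.summable_of_le hle hsum).tsum_le_tsum hle hsum)

theorem continuousOn_changeOrigin_inl [CompleteSpace F] {p : FormalMultilinearSeries ℝ (X × Y) F}
    (hp : 0 < p.radius) {s : Set Y} {y₀ : Y}
    (hs : ∀ y ∈ s, (‖((0 : X), y - y₀)‖₊ : ℝ≥0∞) < p.radius) (n : ℕ) :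
    ContinuousOn (fun y => (p.changeOrigin (0, y - y₀)).compContinuousLinearMap
      (ContinuousLinearMap.inl ℝ X Y) n) s :=
  (ContinuousMultilinearMap.compContinuousLinearMapL
    fun _ => ContinuousLinearMap.inl ℝ X Y).continuous.comp_continuousOn <|
  (p.hasFPowerSeriesOnBall_changeOrigin n hp).continuousOn.comp
    (f := fun y => ((0 : X), y - y₀)) (by fun_prop) fun y hy => by
      simpa [enorm_eq_nnnorm] using! hs y hy

variable [MeasurableSpace Y] [BorelSpace Y] {μ : Measure Y} {K : Set Y} {g : X × Y → F}

theorem eventually_analyticAt_setIntegral [SecondCountableTopology Y] [CompleteSpace F]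
    [IsFiniteMeasure μ] {x₀ : X} {y₀ : Y} (hg : AnalyticAt ℝ g (x₀, y₀)) :
    ∀ᶠ s in (𝓝 y₀).smallSets, MeasurableSet s →
      AnalyticAt ℝ (fun x => ∫ y in s, g (x, y) ∂μ) x₀ := by
  obtain ⟨p, R, hp⟩ := hg
  obtain ⟨ρ, hρ, hρR⟩ : ∃ ρ : ℝ≥0, 0 < ρ ∧ (ρ + ρ : ℝ≥0∞) < R := by
    obtain ⟨r, hr, hrR⟩ := ENNReal.lt_iff_exists_nnreal_btwn.1 hp.r_pos
    exact ⟨r / 2, by simpa using hr, by rwa [← ENNReal.coe_add, add_halves]⟩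
  have hnorm {y : Y} (hy : y ∈ Metric.ball y₀ ρ) : ‖((0 : X), y - y₀)‖₊ ≤ ρ := by
    rw [mem_ball_iff_norm, ← coe_nnnorm, NNReal.coe_lt_coe] at hy
    simpa [Prod.nnnorm_def] using hy.le
  have hlt {y : Y} (hy : y ∈ Metric.ball y₀ ρ) : (‖((0 : X), y - y₀)‖₊ : ℝ≥0∞) < R :=
    (ENNReal.coe_le_coe.2 (hnorm hy)).trans_lt (le_self_add.trans_lt hρR)
  filter_upwards [eventually_smallSets.2 ⟨_, Metric.ball_mem_nhds y₀ (NNReal.coe_pos.2 hρ),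
    fun t ht => ht⟩] with s hs hsm
  -- The expansion of `g` at `(x₀, y₀)`, recentred at `(x₀, y)`, is integrated term by term.
  let q (y : Y) : FormalMultilinearSeries ℝ X F :=
    (p.changeOrigin (0, y - y₀)).compContinuousLinearMap (ContinuousLinearMap.inl ℝ X Y)
  let b (k : ℕ) : ℝ≥0 := ∑' s : Σ l : ℕ, { s : Finset (Fin (k + l)) // s.card = l },
      ‖p (k + s.1)‖₊ * ρ ^ s.1
  have hae {P : Y → Prop} (h : ∀ y ∈ Metric.ball y₀ ρ, P y) : ∀ᵐ y ∂μ.restrict s, P y :=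
    (ae_restrict_iff' hsm).2 (.of_forall fun y hy => h y (hs hy))
  have hρp : (ρ + ρ : ℝ≥0∞) < p.radius := hρR.trans_le hp.r_le
  refine analyticAt_integral_of_hasSum (q := q) (b := fun k => b k) hρ
    (hae fun y hy h hh => ?_) (fun n => ?_) (fun n => hae fun y hy => ?_) ?_
  · have := (hp.changeOrigin (hlt hy)).hasSum (y := (h, 0)) (by
      rw [Metric.mem_eball, edist_zero_right, lt_tsub_iff_right]
      refine lt_of_le_of_lt (add_le_add ?_ (ENNReal.coe_le_coe.2 (hnorm hy))) hρR
      simpa [enorm_eq_nnnorm, Prod.nnnorm_def] using hh.le)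
    simpa [q] using! this
  · exact (continuousOn_changeOrigin_inl (bot_le.trans_lt hρp)
      (fun y hy => (hlt (hs hy)).trans_le hp.r_le) n).aestronglyMeasurable hsm
  · calc ‖q y n‖ ≤ ‖p.changeOrigin (0, y - y₀) n‖ * ∏ _ : Fin n, 1 :=
          (ContinuousMultilinearMap.norm_compContinuousLinearMap_le _ _).trans <| by
            gcongr with i
            exact ContinuousLinearMap.norm_inl_le_one ..
      _ ≤ b n := by
          rw [Finset.prod_const_one, mul_one, ← coe_nnnorm, NNReal.coe_le_coe]
          exact nnnorm_changeOrigin_le_tsum (hnorm hy) (le_self_add.trans_lt hρp) n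
  · have := (NNReal.summable_sigma.1 (p.changeOriginSeries_summable_aux₁ hρp)).2
    simp only [NNReal.tsum_mul_right] at this
    exact_mod_cast this

theorem exists_measurableSet_analyticAt [SecondCountableTopology Y] [CompleteSpace F]
    [IsFiniteMeasure μ] {x₀ : X} (hg : AnalyticOnNhd ℝ g univ) (hK : IsCompact K)
    (hint : ∀ x, Integrable (fun y => g (x, y)) μ) :
    ∃ T, K ⊆ T ∧ MeasurableSet T ∧
      ∀ s ⊆ T, MeasurableSet s → AnalyticAt ℝ (fun x => ∫ y in s, g (x, y) ∂μ) x₀ := by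
  refine hK.induction_on ⟨∅, le_rfl, .empty, fun s hs _ => ?_⟩ ?_ ?_ fun y _ => ?_
  · simpa [subset_empty_iff.1 hs] using analyticAt_const
  · exact fun s t hst ⟨T, hT, h⟩ => ⟨T, hst.trans hT, h⟩
  · rintro _ _ ⟨T₁, hK₁, hm₁, h₁⟩ ⟨T₂, hK₂, hm₂, h₂⟩
    refine ⟨T₁ ∪ T₂, union_subset_union hK₁ hK₂, hm₁.union hm₂, fun s hs hsm => ?_⟩
    refine ((h₁ (s ∩ T₁) inter_subset_right (hsm.inter hm₁)).add
      (h₂ (s \ T₁) (sdiff_subset_iff.2 hs) (hsm.diff hm₁))).congr (.of_forall fun x => ?_)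
    exact integral_inter_add_sdiff hm₁ (hint x).integrableOn
  · obtain ⟨U, hU, h⟩ := eventually_smallSets.1
      (eventually_analyticAt_setIntegral (μ := μ) (hg (x₀, y) (mem_univ _)))
    exact ⟨interior U, nhdsWithin_le_nhds (interior_mem_nhds.2 hU), interior U, subset_rfl,
      isOpen_interior.measurableSet, fun s hs => h s (hs.trans interior_subset)⟩

theorem analyticOnNhd_integral [SecondCountableTopology Y] [CompleteSpace F] [IsFiniteMeasure μ]
    (hK : IsCompact K) (hμ : ∀ᵐ y ∂μ, y ∈ K) (hg : AnalyticOnNhd ℝ g univ) :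
    AnalyticOnNhd ℝ (fun x => ∫ y, g (x, y) ∂μ) univ := by
  intro x₀ _
  have hc : Continuous g := continuousOn_univ.1 hg.continuousOn
  obtain ⟨T, hKT, hT, h⟩ := exists_measurableSet_analyticAt (x₀ := x₀) hg hK
    fun x => integrable_of_continuous hK hμ (hc.comp (.prodMk_right x))
  simpa only [Measure.restrict_eq_self_of_ae_mem (hμ.mono fun _ hy => hKT hy)] using
    h T subset_rfl hT

theorem hasFDerivAt_integral [SecondCountableTopology Y] [ProperSpace X] [IsFiniteMeasure μ]
    (hK : IsCompact K) (hμ : ∀ᵐ y ∂μ, y ∈ K) (hg : ContDiff ℝ 1 g) (x₀ : X) :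
    HasFDerivAt (fun x => ∫ y, g (x, y) ∂μ)
      (∫ y, (fderiv ℝ g (x₀, y)).comp (ContinuousLinearMap.inl ℝ X Y) ∂μ) x₀ := by
  have hc : Continuous g := hg.continuous
  have hc' : Continuous fun z => (fderiv ℝ g z).comp (ContinuousLinearMap.inl ℝ X Y) :=
    (hg.continuous_fderiv one_ne_zero).clm_comp continuous_const
  obtain ⟨M, hM⟩ := ((isCompact_closedBall x₀ 1).prod hK).bddAbove_image hc'.norm.continuousOn
  refine hasFDerivAt_integral_of_dominated_of_fderiv_le (bound := fun _ => M)
    (F' := fun x y => (fderiv ℝ g (x, y)).comp (ContinuousLinearMap.inl ℝ X Y))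
    (Metric.closedBall_mem_nhds x₀ one_pos)
    (.of_forall fun x => (hc.comp (.prodMk_right x)).aestronglyMeasurable)
    (integrable_of_continuous hK hμ (hc.comp (.prodMk_right x₀)))
    (hc'.comp (.prodMk_right x₀)).aestronglyMeasurable ?_ (integrable_const M) ?_
  · exact hμ.mono fun y hy x hx => hM (mem_image_of_mem _ (mk_mem_prod hx hy))
  · exact .of_forall fun y x _ => (hg.differentiable one_ne_zero (x, y)).hasFDerivAt.comp x
      (hasFDerivAt_prodMk_left x y)

theorem fderiv_integral_apply [SecondCountableTopology Y] [ProperSpace X] [IsFiniteMeasure μ]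
    (hK : IsCompact K) (hμ : ∀ᵐ y ∂μ, y ∈ K) (hg : ContDiff ℝ 1 g) (x v : X) :
    fderiv ℝ (fun x => ∫ y, g (x, y) ∂μ) x v = ∫ y, fderiv ℝ g (x, y) (v, 0) ∂μ := by
  have hc : Continuous fun y => (fderiv ℝ g (x, y)).comp (ContinuousLinearMap.inl ℝ X Y) :=
    ((hg.continuous_fderiv one_ne_zero).comp (.prodMk_right x)).clm_comp continuous_const
  rw [(hasFDerivAt_integral hK hμ hg x).fderiv,
    ContinuousLinearMap.integral_apply (integrable_of_continuous hK hμ hc)]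
  rfl

end ParametricIntegral

section WaveOperator

variable {R A ι : Type*} [CommRing R] [CommRing A] [Algebra R A] (Dt : Derivation R A A)
  (D : ι → Derivation R A A)

/-- The ideal generated by `u` and its first derivatives. Membership in it of `a * □ u` says that
`u` solves a linear homogeneous second order equation with principal part `a □`. -/
def firstJetIdeal (u : A) : Ideal A :=
  Ideal.span ({u, Dt u} ∪ range fun j => D j u)

variable {Dt D}

theorem self_mem_firstJetIdeal (u : A) : u ∈ firstJetIdeal Dt D u :=
  Ideal.subset_span (by simp)

theorem dt_mem_firstJetIdeal (u : A) : Dt u ∈ firstJetIdeal Dt D u :=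
  Ideal.subset_span (by simp)

theorem dx_mem_firstJetIdeal (u : A) (j : ι) : D j u ∈ firstJetIdeal Dt D u :=
  Ideal.subset_span (by simp)

variable (Dt) in
/-- The elements that lie in `J` together with their first `n - 1` derivatives under `Dt`. When `J`
is the ideal of functions vanishing on a surface transversal to `Dt`, these are the functions
vanishing to order `n` on it. -/
def contactIdeal (J : Ideal A) (n : ℕ) : Ideal A where
  carrier := {u | ∀ k < n, Dt^[k] u ∈ J}
  zero_mem' k _ := by simp [iterate_map_zero]
  add_mem' hu hv k hk := by
    rw [iterate_map_add]
    exact J.add_mem (hu k hk) (hv k hk)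
  smul_mem' c u hu := by
    induction n generalizing c u with
    | zero => simp
    | succ n ih =>
      rintro (_ | k) hk
      · exact J.mul_mem_left c (hu 0 hk)
      · have hlow : ∀ k < n, Dt^[k] u ∈ J := fun k hk => hu k (hk.trans n.lt_succ_self)
        have hDt : ∀ k < n, Dt^[k] (Dt u) ∈ J := fun k hk => hu (k + 1) (Nat.succ_lt_succ hk)
        rw [Function.iterate_succ_apply, smul_eq_mul, Derivation.leibniz, iterate_map_add]
        exact J.add_mem (ih c _ hDt k (Nat.lt_of_succ_lt_succ hk))
          (by simpa [mul_comm] using ih (Dt c) u hlow k (Nat.lt_of_succ_lt_succ hk))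

variable {J : Ideal A} {n : ℕ} {u a : A}

theorem mem_contactIdeal : u ∈ contactIdeal Dt J n ↔ ∀ k < n, Dt^[k] u ∈ J := .rfl

theorem mem_contactIdeal_succ :
    u ∈ contactIdeal Dt J (n + 1) ↔ u ∈ J ∧ Dt u ∈ contactIdeal Dt J n := by
  simp only [mem_contactIdeal, ← Function.iterate_succ_apply]
  refine ⟨fun h => ⟨h 0 n.succ_pos, fun k hk => h (k + 1) (Nat.succ_lt_succ hk)⟩, ?_⟩
  rintro ⟨h₀, h⟩ (_ | k) hk
  exacts [h₀, h k (Nat.lt_of_succ_lt_succ hk)]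

theorem contactIdeal_succ_le : contactIdeal Dt J (n + 1) ≤ contactIdeal Dt J n :=
  fun _ h k hk => h k (hk.trans n.lt_succ_self)

theorem derivation_mem_contactIdeal {δ : Derivation R A A} (hcomm : ∀ a, Dt (δ a) = δ (Dt a))
    (hJ : ∀ a ∈ J, δ a ∈ J) (hu : u ∈ contactIdeal Dt J n) : δ u ∈ contactIdeal Dt J n := by
  intro k hk
  rw [(Function.Commute.iterate_left (f := Dt) hcomm k).eq]
  exact hJ _ (hu k hk)

theorem mem_contactIdeal_of_mul_mem (ha : ∀ b, a * b ∈ J → b ∈ J)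
    (hu : a * u ∈ contactIdeal Dt J n) : u ∈ contactIdeal Dt J n := by
  induction n generalizing u with
  | zero => simp [mem_contactIdeal]
  | succ n ih =>
    have hun : u ∈ contactIdeal Dt J n := ih (contactIdeal_succ_le hu)
    rw [mem_contactIdeal_succ] at hu ⊢
    refine ⟨ha u hu.1, ih ?_⟩
    have := (contactIdeal Dt J n).sub_mem hu.2 ((contactIdeal Dt J n).mul_mem_right (Dt a) hun)
    simpa using this

variable [Fintype ι]

variable (D) in
/-- The Laplacian `Δ u`. -/
def laplacian (u : A) : A := ∑ i, D i (D i u)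

variable (Dt D) in
/-- The wave operator `□ u = ∂ₜ² u - Δ u`. -/
def box (u : A) : A := Dt (Dt u) - laplacian D u

theorem box_sum {κ : Type*} (s : Finset κ) (u : κ → A) :
    box Dt D (∑ i ∈ s, u i) = ∑ i ∈ s, box Dt D (u i) := by
  simp only [box, laplacian, map_sum, Finset.sum_sub_distrib]
  rw [Finset.sum_comm]

theorem box_mul_self (u : A) :
    box Dt D (u * u) = 2 * (u * box Dt D u + (Dt u * Dt u - ∑ j, D j u * D j u)) := by
  simp only [box, laplacian, Derivation.leibniz, map_add, smul_eq_mul, Finset.sum_add_distrib,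
    ← Finset.mul_sum]
  ring

theorem mem_contactIdeal_of_mul_box_mem (hDt : ∀ i a, Dt (D i a) = D i (Dt a))
    (hJ : ∀ i, ∀ a ∈ J, D i a ∈ J) (ha : ∀ b, a * b ∈ J → b ∈ J)
    (hbox : a * box Dt D u ∈ firstJetIdeal Dt D u) (hu₀ : u ∈ J) (hu₁ : Dt u ∈ J) (n : ℕ) :
    u ∈ contactIdeal Dt J (n + 1) := by
  induction n with
  | zero => simpa [mem_contactIdeal] using hu₀
  | succ n ih =>
    have hun : u ∈ contactIdeal Dt J n := contactIdeal_succ_le ih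
    have hD (i : ι) {v : A} (hv : v ∈ contactIdeal Dt J n) : D i v ∈ contactIdeal Dt J n :=
      derivation_mem_contactIdeal (hDt i) (hJ i) hv
    have hjet : firstJetIdeal Dt D u ≤ contactIdeal Dt J n := by
      refine Ideal.span_le.2 (union_subset (pair_subset hun (mem_contactIdeal_succ.1 ih).2) ?_)
      exact range_subset_iff.2 fun i => hD i hun
    have hΔ : laplacian D u ∈ contactIdeal Dt J n := Ideal.sum_mem _ fun i _ => hD i (hD i hun)
    have hDt₂ : Dt (Dt u) ∈ contactIdeal Dt J n := by
      have := Ideal.add_mem _ (mem_contactIdeal_of_mul_mem ha (hjet hbox)) hΔ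
      rwa [box, sub_add_cancel] at this
    exact mem_contactIdeal_succ.2 ⟨hu₀, mem_contactIdeal_succ.2 ⟨hu₁, hDt₂⟩⟩

end WaveOperator

section RiemannSilberstein

variable {A : Type*} [CommRing A] [Algebra ℂ A] (Dt : Derivation ℂ A A)
  (D : Fin 3 → Derivation ℂ A A)

/-- The components of `∇ × F`, with indices modulo `3`. -/
def rot (F : Fin 3 → A) (i : Fin 3) : A :=
  D (i + 1) (F (i + 2)) - D (i + 2) (F (i + 1))

/-- The divergence `∇ · F`. -/
def div (F : Fin 3 → A) : A := ∑ i, D i (F i)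

/-- Maxwell's equations `∂ₜ F = -i ∇ × F`, `∇ · F = 0` for the Riemann–Silberstein field
`F = E + i B`, in an abstract commutative algebra with derivations `∂ₜ, ∂₀, ∂₁, ∂₂`. -/
structure IsRiemannSilberstein (F : Fin 3 → A) : Prop where
  evolution : ∀ i, Dt (F i) = -(algebraMap ℂ A Complex.I * rot D F i)
  div_eq_zero : div D F = 0

variable {Dt D} {F : Fin 3 → A}

theorem sum_eq_add_add_cyclic {M : Type*} [AddCommMonoid M] (f : Fin 3 → M) (k : Fin 3) :
    ∑ i, f i = f k + f (k + 1) + f (k + 2) := by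
  rw [← Equiv.sum_comp (Equiv.addLeft k), Fin.sum_univ_three]
  simp

theorem algebraMap_I_mul_self : algebraMap ℂ A Complex.I * algebraMap ℂ A Complex.I = -1 := by
  rw [← map_mul, Complex.I_mul_I, map_neg, map_one]

theorem derivation_I_mul (δ : Derivation ℂ A A) (a : A) :
    δ (algebraMap ℂ A Complex.I * a) = algebraMap ℂ A Complex.I * δ a := by
  simp

theorem rot_rot (hD : ∀ i j a, D i (D j a) = D j (D i a)) (F : Fin 3 → A) (i : Fin 3) :
    rot D (rot D F) i = D i (div D F) - laplacian D (F i) := by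
  have h₃ : (2 : Fin 3) + 1 = 0 := rfl
  have h₄ : (2 : Fin 3) + 2 = 1 := rfl
  have h₂ : (1 : Fin 3) + 1 = 2 := rfl
  have h₁ : (1 : Fin 3) + 2 = 0 := rfl
  simp only [div, laplacian, sum_eq_add_add_cyclic _ i, rot, map_sub, map_add,
    add_assoc, h₁, h₂, h₃, h₄, add_zero, hD i]
  ring

theorem div_rot (hD : ∀ i j a, D i (D j a) = D j (D i a)) (F : Fin 3 → A) :
    div D (rot D F) = 0 := by
  simp only [div, rot, map_sub, Fin.sum_univ_three, Fin.isValue, Fin.reduceAdd, hD 1 0, hD 2 0,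
    hD 2 1]
  ring

theorem isRiemannSilberstein_of_box_eq_zero (hD : ∀ i j a, D i (D j a) = D j (D i a))
    (hDt : ∀ i a, Dt (D i a) = D i (Dt a)) (hbox : ∀ i, box Dt D (F i) = 0) (hdiv : div D F = 0) :
    IsRiemannSilberstein Dt D
      (fun i => Dt (F i) - algebraMap ℂ A Complex.I * rot D F i) where
  evolution i := by
    have hrot : rot D (fun i => Dt (F i) - algebraMap ℂ A Complex.I * rot D F i) i =
        Dt (rot D F i) - algebraMap ℂ A Complex.I * rot D (rot D F) i := by
      simp only [rot, map_sub, hDt, derivation_I_mul]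
      ring
    have hrr := rot_rot hD F i
    have hwave := hbox i
    rw [hdiv, map_zero, zero_sub] at hrr
    rw [box] at hwave
    rw [hrot, map_sub, derivation_I_mul]
    linear_combination hwave + hrr - rot D (rot D F) i * algebraMap_I_mul_self (A := A)
  div_eq_zero := by
    have hrot := div_rot hD F
    have hdt : ∑ i, D i (Dt (F i)) = 0 := by
      simp only [← hDt, ← map_sum]
      exact (congrArg Dt hdiv).trans (map_zero Dt)
    rw [div] at hrot
    simp only [div, map_sub, derivation_I_mul, Finset.sum_sub_distrib, hdt,
      ← Finset.mul_sum, hrot, mul_zero, sub_zero]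

theorem IsRiemannSilberstein.box_eq_zero (h : IsRiemannSilberstein Dt D F)
    (hD : ∀ i j a, D i (D j a) = D j (D i a)) (hDt : ∀ i a, Dt (D i a) = D i (Dt a)) (i : Fin 3) :
    box Dt D (F i) = 0 := by
  have hrot : Dt (rot D F i) = -(algebraMap ℂ A Complex.I * rot D (rot D F) i) := by
    simp only [rot, map_sub, hDt, h.evolution, map_neg, derivation_I_mul]
    ring
  rw [box, h.evolution, map_neg, derivation_I_mul, hrot, rot_rot hD, h.div_eq_zero, map_zero]
  linear_combination (- laplacian D (F i)) * algebraMap_I_mul_self (A := A)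

theorem sq_mul_eq_of_trace_eq_zero {A : Type*} [CommRing A] (d : Fin 3 → Fin 3 → A) (F : Fin 3 → A)
    (k : Fin 3) (hd : ∑ i, d i i = 0) :
    let P : Fin 3 → A := fun j => ∑ m, d j m * F m
    let w : Fin 3 → A := fun i => d (i + 1) (i + 2) - d (i + 2) (i + 1)
    let q : A := ∑ i, F i * w i
    F k ^ 2 * -(∑ i, w i ^ 2 + ∑ i, ∑ j, d i j ^ 2) =
      2 * ∑ j, (∑ m, d m j * F m - F k * (d j k + d k j) + d k k * F j) * P j +
        2 * (P k - 2 * ∑ m, d m k * F m) * P k +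
        2 * (q - 2 * F k * w k - (F (k + 1) * d (k + 2) k - F (k + 2) * d (k + 1) k)) * q +
        (∑ i, F i * F i) *
          (4 * ∑ i, d k i * d i k - 2 * ∑ i, d k i ^ 2 - ∑ i, ∑ j, d i j * d j i) := by
  have h₃ : (2 : Fin 3) + 1 = 0 := rfl
  have h₄ : (2 : Fin 3) + 2 = 1 := rfl
  have h₂ : (1 : Fin 3) + 1 = 2 := rfl
  have h₁ : (1 : Fin 3) + 2 = 0 := rfl
  simp only [sum_eq_add_add_cyclic _ k, add_assoc, h₁, h₂, h₃, h₄, add_zero] at hd ⊢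
  rw [← eq_neg_iff_add_eq_zero] at hd
  rw [hd]
  ring

/-- The square `∑ᵢ Fᵢ²` of a complex vector field. For `F = E + i B` it is
`E · E - B · B + 2 i E · B`, which vanishes exactly where the field is null. -/
def complexSq (F : Fin 3 → A) : A := ∑ i, F i * F i

theorem derivation_complexSq (δ : Derivation ℂ A A) :
    δ (complexSq F) = 2 * ∑ i, δ (F i) * F i := by
  simp only [complexSq, map_sum, Derivation.leibniz, smul_eq_mul, Finset.mul_sum]
  exact Finset.sum_congr rfl fun i _ => by ring

theorem IsRiemannSilberstein.dt_complexSq (h : IsRiemannSilberstein Dt D F) :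
    Dt (complexSq F) = -(algebraMap ℂ A (2 * Complex.I) * ∑ i, F i * rot D F i) := by
  simp only [derivation_complexSq, h.evolution, map_mul, map_ofNat, Finset.mul_sum,
    ← Finset.sum_neg_distrib]
  exact Finset.sum_congr rfl fun i _ => by ring

theorem IsRiemannSilberstein.box_complexSq (h : IsRiemannSilberstein Dt D F)
    (hD : ∀ i j a, D i (D j a) = D j (D i a)) (hDt : ∀ i a, Dt (D i a) = D i (Dt a)) :
    box Dt D (complexSq F) = 2 * -(∑ i, rot D F i ^ 2 + ∑ j, ∑ i, D j (F i) ^ 2) := by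
  have hsq (i : Fin 3) : Dt (F i) * Dt (F i) = -rot D F i ^ 2 := by
    rw [h.evolution]
    linear_combination rot D F i ^ 2 * algebraMap_I_mul_self (A := A)
  simp only [complexSq, box_sum, box_mul_self, h.box_eq_zero hD hDt, hsq, mul_zero, zero_add]
  simp only [← Finset.mul_sum, Finset.sum_sub_distrib, Finset.sum_neg_distrib, ← pow_two]
  rw [Finset.sum_comm]
  ring

theorem IsRiemannSilberstein.sq_mul_box_complexSq_mem (h : IsRiemannSilberstein Dt D F)
    (hD : ∀ i j a, D i (D j a) = D j (D i a)) (hDt : ∀ i a, Dt (D i a) = D i (Dt a)) (k : Fin 3) :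
    F k ^ 2 * box Dt D (complexSq F) ∈ firstJetIdeal Dt D (complexSq F) := by
  set J := firstJetIdeal Dt D (complexSq F)
  have htwo : algebraMap ℂ A (1 / 2) * 2 = 1 := by
    rw [← map_ofNat (algebraMap ℂ A) 2, ← map_mul]
    norm_num
  have hgrad (j : Fin 3) : ∑ m, D j (F m) * F m ∈ J := by
    convert J.mul_mem_left (algebraMap ℂ A (1 / 2)) (dx_mem_firstJetIdeal (complexSq F) j) using 1
    rw [derivation_complexSq]
    linear_combination (-∑ m, D j (F m) * F m) * htwo
  have hflux : ∑ i, F i * rot D F i ∈ J := by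
    convert J.mul_mem_left (algebraMap ℂ A (1 / 2) * algebraMap ℂ A Complex.I)
      (dt_mem_firstJetIdeal (complexSq F)) using 1
    rw [h.dt_complexSq, map_mul, map_ofNat]
    linear_combination (-∑ i, F i * rot D F i) * htwo +
      (∑ i, F i * rot D F i) * algebraMap ℂ A (1 / 2) * 2 * algebraMap_I_mul_self (A := A)
  rw [h.box_complexSq hD hDt, mul_left_comm]
  refine J.mul_mem_left _ ?_
  rw [show ∑ j, ∑ i, D j (F i) ^ 2 = ∑ j, ∑ i, (fun j i => D j (F i)) j i ^ 2 from rfl]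
  have := sq_mul_eq_of_trace_eq_zero (fun j i => D j (F i)) F k h.div_eq_zero
  refine (congrArg (· ∈ J) this).mpr (J.add_mem (J.add_mem (J.add_mem ?_ ?_) ?_) ?_)
  · exact J.mul_mem_left _ (J.sum_mem fun j _ => J.mul_mem_left _ (hgrad j))
  · exact J.mul_mem_left _ (hgrad k)
  · exact J.mul_mem_left _ hflux
  · exact J.mul_mem_right _ (self_mem_firstJetIdeal _)

end RiemannSilberstein

section AnalyticAlgebra

variable {X : Type*} [NormedAddCommGroup X] [NormedSpace ℝ X]

variable (X) in
/-- The subalgebra of real-analytic functions in `X → ℂ`, with analyticity encoded as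
`ContDiff ℝ ω`. -/
def analyticSubalgebra : Subalgebra ℂ (X → ℂ) where
  carrier := {f | ContDiff ℝ ω f}
  mul_mem' {f g} (hf : ContDiff ℝ ω f) (hg : ContDiff ℝ ω g) := hf.mul hg
  add_mem' {f g} (hf : ContDiff ℝ ω f) (hg : ContDiff ℝ ω g) := hf.add hg
  algebraMap_mem' c := (contDiff_const : ContDiff ℝ ω fun _ : X => c)

variable (X) in
/-- The algebra of real-analytic functions `X → ℂ`, on which directional derivatives act as
derivations. -/
def AnalyticFunction : Type _ := analyticSubalgebra X

namespace AnalyticFunction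

instance : CommRing (AnalyticFunction X) := inferInstanceAs (CommRing (analyticSubalgebra X))

instance : Algebra ℂ (AnalyticFunction X) := inferInstanceAs (Algebra ℂ (analyticSubalgebra X))

instance : FunLike (AnalyticFunction X) X ℂ where
  coe f := f.1
  coe_injective := Subtype.coe_injective

@[ext]
theorem ext {f g : AnalyticFunction X} (h : ∀ x, f x = g x) : f = g := DFunLike.ext f g h

variable (X) in
/-- The inclusion of the analytic functions into all functions. -/
def coeAlgHom : AnalyticFunction X →ₐ[ℂ] X → ℂ := (analyticSubalgebra X).val

@[simp]
theorem coe_add (f g : AnalyticFunction X) : ⇑(f + g) = f + g := rfl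

@[simp]
theorem coe_mul (f g : AnalyticFunction X) : ⇑(f * g) = f * g := rfl

@[simp]
theorem coe_zero : ⇑(0 : AnalyticFunction X) = 0 := rfl

@[simp]
theorem coe_sub (f g : AnalyticFunction X) : ⇑(f - g) = f - g := rfl

@[simp]
theorem coe_neg (f : AnalyticFunction X) : ⇑(-f) = -f := rfl

@[simp]
theorem coe_pow (f : AnalyticFunction X) (n : ℕ) : ⇑(f ^ n) = f ^ n :=
  map_pow (coeAlgHom X) f n

@[simp]
theorem coe_algebraMap (c : ℂ) : ⇑(algebraMap ℂ (AnalyticFunction X) c) = fun _ => c := rfl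

@[simp]
theorem coe_sum {κ : Type*} (s : Finset κ) (f : κ → AnalyticFunction X) :
    ⇑(∑ i ∈ s, f i) = ∑ i ∈ s, ⇑(f i) :=
  map_sum (coeAlgHom X) f s

end AnalyticFunction

theorem contDiff_coe (f : AnalyticFunction X) : ContDiff ℝ ω f := f.2

@[fun_prop]
theorem differentiable_coe (f : AnalyticFunction X) : Differentiable ℝ ⇑f :=
  (contDiff_coe f).differentiable (by simp)

theorem analyticOnNhd_coe (f : AnalyticFunction X) : AnalyticOnNhd ℝ ⇑f univ :=
  contDiff_omega_iff_analyticOnNhd.1 f.2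

/-- The directional derivative along `v`. -/
def dirDeriv (v : X) : Derivation ℂ (AnalyticFunction X) (AnalyticFunction X) :=
  Derivation.mk'
    { toFun := fun f => ⟨fun x => fderiv ℝ ⇑f x v,
        ((contDiff_coe f).fderiv_right (m := ω) le_top).clm_apply contDiff_const⟩
      map_add' := fun f g => AnalyticFunction.ext fun x =>
        congr($(fderiv_add (differentiable_coe f x) (differentiable_coe g x)) v)
      map_smul' := fun c f => AnalyticFunction.ext fun x =>
        congr($(fderiv_const_smul (differentiable_coe f x) c) v) }
    fun f g => AnalyticFunction.ext fun x =>
      congr($(fderiv_mul (differentiable_coe f x) (differentiable_coe g x)) v)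

theorem dirDeriv_apply (v : X) (f : AnalyticFunction X) (x : X) :
    dirDeriv v f x = fderiv ℝ ⇑f x v := rfl

theorem dirDeriv_comm (v w : X) (f : AnalyticFunction X) :
    dirDeriv v (dirDeriv w f) = dirDeriv w (dirDeriv v f) := by
  ext x
  have hd : DifferentiableAt ℝ (fderiv ℝ ⇑f) x :=
    ((contDiff_coe f).fderiv_right (m := ω) le_top).differentiable (by simp) x
  have hsymm : IsSymmSndFDerivAt ℝ f x :=
    (contDiff_coe f).contDiffAt.isSymmSndFDerivAt (by simp)
  have (u u' : X) : (dirDeriv u (dirDeriv u' f) : X → ℂ) x =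
      fderiv ℝ (fderiv ℝ ⇑f) x u u' := by
    rw [dirDeriv_apply]
    simp [funext (dirDeriv_apply u' f), fderiv_clm_apply hd (differentiableAt_const u')]
  rw [this, this, hsymm]

theorem eq_of_eventuallyEq {f g : AnalyticFunction X} {x : X} (h : ⇑f =ᶠ[𝓝 x] g) : f = g :=
  DFunLike.coe_injective ((analyticOnNhd_coe f).eq_of_eventuallyEq (analyticOnNhd_coe g) h)

/-- The ideal of analytic functions vanishing on `S`. -/
def vanishingOn (S : Set X) : Ideal (AnalyticFunction X) where
  carrier := {f | ∀ x ∈ S, f x = 0}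
  zero_mem' _ _ := rfl
  add_mem' hf hg x hx := by simp [hf x hx, hg x hx]
  smul_mem' c f hf x hx := by simp [hf x hx]

end AnalyticAlgebra

section SpaceTime

variable {X : Type*} [NormedAddCommGroup X] [NormedSpace ℝ X]

theorem iteratedDeriv_time (f : AnalyticFunction (ℝ × X)) (n : ℕ) (x : X) :
    iteratedDeriv n (fun t => f (t, x)) =
      fun t => ((dirDeriv (1, 0))^[n] f) (t, x) := by
  induction n generalizing f with
  | zero => simp
  | succ n ih =>
    have hf : deriv (fun t => f (t, x)) =
        fun t => dirDeriv (1, 0) f (t, x) :=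
      funext fun t => deriv_prodMk_left (differentiable_coe f (t, x))
    rw [iteratedDeriv_succ', hf, ih, Function.iterate_succ_apply]

theorem dirDeriv_space_mem_vanishingOn {U : Set X} (hU : IsOpen U) (v : X)
    {f : AnalyticFunction (ℝ × X)} (hf : f ∈ vanishingOn ({0} ×ˢ U)) :
    dirDeriv (0, v) f ∈ vanishingOn ({0} ×ˢ U) := by
  rintro ⟨_, x⟩ ⟨rfl, hx⟩
  have hf₀ : (fun y => f (0, y)) =ᶠ[𝓝 x] fun _ => 0 := by
    filter_upwards [hU.mem_nhds hx] with y hy using hf (0, y) ⟨rfl, hy⟩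
  rw [dirDeriv_apply, ← fderiv_prodMk_right_apply (differentiable_coe f (0, x)), hf₀.fderiv_eq]
  simp

theorem eq_zero_of_mem_contactIdeal {U : Set X} (hU : IsOpen U) (hne : U.Nonempty)
    {f : AnalyticFunction (ℝ × X)}
    (hf : ∀ n, f ∈ contactIdeal (dirDeriv (1, 0)) (vanishingOn ({0} ×ˢ U)) (n + 1)) : f = 0 := by
  have hline (x : X) (hx : x ∈ U) (t : ℝ) : f (t, x) = 0 := by
    have ha : AnalyticOnNhd ℝ (fun s => f (s, x)) univ :=
      contDiff_omega_iff_analyticOnNhd.1 ((contDiff_coe f).comp (by fun_prop))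
    have htop : analyticOrderAt (fun s => f (s, x)) 0 = ⊤ := by
      refine ENat.eq_top_iff_forall_ge.2 fun n => ?_
      refine (natCast_le_analyticOrderAt_iff_iteratedDeriv_eq_zero (ha 0 (mem_univ _))).2
        fun i _ => ?_
      rw [iteratedDeriv_time]
      exact hf i i i.lt_succ_self (0, x) ⟨rfl, hx⟩
    exact congrFun (ha.eq_of_eventuallyEq (g := fun _ => 0) analyticOnNhd_const
      (analyticOrderAt_eq_top.1 htop)) t
  obtain ⟨x, hx⟩ := hne
  refine eq_of_eventuallyEq (x := (0, x)) ?_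
  filter_upwards [(isOpen_univ.prod hU).mem_nhds ⟨mem_univ (0 : ℝ), hx⟩] with p hp
  exact hline p.2 hp.2 p.1

end SpaceTime

section Sphere

variable (E : Type*) [NormedAddCommGroup E] [InnerProductSpace ℝ E] [FiniteDimensional ℝ E]
  [MeasurableSpace E] [BorelSpace E]

/-- The uniform probability measure on the unit sphere, as a measure on the ambient space. -/
def uniformSphere : Measure E :=
  (ProbabilityTheory.cond (volume : Measure E).toSphere univ).map (↑)

instance : IsFiniteMeasure (uniformSphere E) :=
  inferInstanceAs (IsFiniteMeasure (Measure.map ..))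

instance [Nontrivial E] : IsProbabilityMeasure (uniformSphere E) := by
  have : IsProbabilityMeasure (ProbabilityTheory.cond (volume : Measure E).toSphere univ) :=
    ProbabilityTheory.cond_isProbabilityMeasure <|
      Measure.measure_univ_ne_zero.2 (Measure.toSphere_ne_zero _)
  exact Measure.isProbabilityMeasure_map measurable_subtype_coe.aemeasurable

theorem ae_uniformSphere_norm_eq_one : ∀ᵐ y ∂uniformSphere E, ‖y‖ = 1 := by
  refine (ae_map_iff measurable_subtype_coe.aemeasurable ?_).2 (.of_forall fun y => ?_)
  · exact measurableSet_eq_fun measurable_norm measurable_const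
  · exact norm_eq_of_mem_sphere y

variable {E}

theorem measurePreserving_uniformSphere (e : E ≃ₗᵢ[ℝ] E) :
    MeasurePreserving e (uniformSphere E) (uniformSphere E) := by
  have hcone (s : Set E) : e ⁻¹' (Ioo (0 : ℝ) 1 • (Metric.sphere 0 1 ∩ s)) =
      Ioo (0 : ℝ) 1 • (Metric.sphere 0 1 ∩ e ⁻¹' s) := by
    ext y
    simp only [mem_preimage, Set.mem_smul, mem_inter_iff, mem_sphere_zero_iff_norm]
    constructor
    · rintro ⟨c, hc, z, ⟨hz, hzs⟩, hcz⟩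
      exact ⟨c, hc, e.symm z, by simpa [hz] using hzs, by rw [← map_smul, hcz, e.symm_apply_apply]⟩
    · rintro ⟨c, hc, z, ⟨hz, hzs⟩, rfl⟩
      exact ⟨c, hc, e z, ⟨by simpa using hz, hzs⟩, (map_smul e c z).symm⟩
  refine ⟨e.continuous.measurable, Measure.ext fun s hs => ?_⟩
  have hes : MeasurableSet (e ⁻¹' s) := e.continuous.measurable hs
  rw [Measure.map_apply e.continuous.measurable hs]
  simp only [uniformSphere, Measure.map_apply measurable_subtype_coe, hs, hes,
    ProbabilityTheory.cond_apply MeasurableSet.univ, univ_inter,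
    Measure.toSphere_apply' _ (measurable_subtype_coe _), Subtype.image_preimage_coe, ← hcone]
  rw [e.measurePreserving.measure_preimage_emb e.toHomeomorph.measurableEmbedding]

theorem integral_uniformSphere_fderiv_skewAdjoint {F : Type*} [NormedAddCommGroup F]
    [NormedSpace ℝ F] {h : E → F} (hh : ContDiff ℝ 1 h)
    {A : E →L[ℝ] E} (hA : A ∈ skewAdjoint (E →L[ℝ] E)) :
    ∫ y, fderiv ℝ h y (A y) ∂uniformSphere E = 0 := by
  let +nondep : NormedAlgebra ℚ (E →L[ℝ] E) := .restrictScalars ℚ ℝ _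
  let g : ℝ × E → F := fun p => h (NormedSpace.exp (p.1 • A) p.2)
  have hg : ContDiff ℝ 1 g := by
    have hexp : ContDiff ℝ 1 (NormedSpace.exp : (E →L[ℝ] E) → E →L[ℝ] E) :=
      (show AnalyticOnNhd ℝ _ univ from fun B _ => NormedSpace.exp_analytic B).contDiff
    exact hh.comp ((hexp.comp (contDiff_fst.smul contDiff_const)).clm_apply contDiff_snd)
  have hconst (θ : ℝ) : ∫ y, g (θ, y) ∂uniformSphere E = ∫ y, h y ∂uniformSphere E := by
    have hU : NormedSpace.exp (θ • A) ∈ unitary (E →L[ℝ] E) :=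
      NormedSpace.exp_mem_unitary_of_mem_skewAdjoint (skewAdjoint.smul_mem θ hA)
    let e := Unitary.linearIsometryEquiv ⟨_, hU⟩
    exact (measurePreserving_uniformSphere e).integral_comp e.toHomeomorph.measurableEmbedding h
  have hderiv (y : E) : fderiv ℝ g (0, y) (1, 0) = fderiv ℝ h y (A y) := by
    have hexp := ((hasDerivAt_exp_smul_const A (0 : ℝ)).clm_apply (hasDerivAt_const 0 y))
    have hpath : HasDerivAt (fun θ : ℝ => (θ, y)) (1, 0) 0 :=
      (hasDerivAt_id _).prodMk (hasDerivAt_const _ y)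
    have := (hg.differentiable one_ne_zero (0, y)).hasFDerivAt.comp_hasDerivAt (0 : ℝ) hpath
    refine this.unique ?_
    have hy : y = NormedSpace.exp ((0 : ℝ) • A) y := by simp
    have h₂ := (hy ▸ hh.differentiable one_ne_zero y).hasFDerivAt.comp_hasDerivAt (0 : ℝ) hexp
    simpa using! h₂
  rw [← integral_congr_ae (.of_forall hderiv), ← fderiv_integral_apply
    (isCompact_sphere (0 : E) 1) ?_ hg]
  · simp [hconst]
  · simpa using ae_uniformSphere_norm_eq_one E

variable {ι : Type*} [Fintype ι]

variable (ι) in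
/-- The uniform probability measure on the Euclidean unit sphere of `ι → ℝ`. -/
def sphereMeasure : Measure (ι → ℝ) :=
  (uniformSphere (EuclideanSpace ℝ ι)).map WithLp.ofLp

instance : IsFiniteMeasure (sphereMeasure ι) :=
  inferInstanceAs (IsFiniteMeasure (Measure.map ..))

instance [Nonempty ι] : IsProbabilityMeasure (sphereMeasure ι) :=
  Measure.isProbabilityMeasure_map (WithLp.measurable_ofLp ..).aemeasurable

theorem ae_sphereMeasure_sum_sq_eq_one : ∀ᵐ y ∂sphereMeasure ι, ∑ i, y i ^ 2 = 1 := by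
  refine (ae_map_iff (WithLp.measurable_ofLp ..).aemeasurable ?_).2 ?_
  · exact measurableSet_eq_fun (by fun_prop) measurable_const
  · filter_upwards [ae_uniformSphere_norm_eq_one (EuclideanSpace ℝ ι)] with y hy
    rw [← EuclideanSpace.real_norm_sq_eq, hy, one_pow]

theorem ae_sphereMeasure_mem_closedBall :
    ∀ᵐ y ∂sphereMeasure ι, y ∈ Metric.closedBall (0 : ι → ℝ) 1 := by
  filter_upwards [ae_sphereMeasure_sum_sq_eq_one] with y hy
  rw [mem_closedBall_zero_iff, pi_norm_le_iff_of_nonneg zero_le_one]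
  intro i
  rw [Real.norm_eq_abs, ← sq_le_one_iff_abs_le_one, ← hy]
  exact Finset.single_le_sum (fun i _ => sq_nonneg (y i)) (Finset.mem_univ i)

theorem integral_sphereMeasure_rotation [DecidableEq ι] {F : Type*} [NormedAddCommGroup F]
    [NormedSpace ℝ F] {h : (ι → ℝ) → F} (hh : ContDiff ℝ 1 h) (i j : ι) :
    ∫ y, fderiv ℝ h y (y i • Pi.single j 1 - y j • Pi.single i 1) ∂sphereMeasure ι = 0 := by
  let e (k : ι) : EuclideanSpace ℝ ι := EuclideanSpace.single k 1
  let A := InnerProductSpace.rankOne ℝ (e j) (e i) - InnerProductSpace.rankOne ℝ (e i) (e j)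
  have hA : A ∈ skewAdjoint (EuclideanSpace ℝ ι →L[ℝ] EuclideanSpace ℝ ι) := by
    simp [skewAdjoint.mem_iff, A, ContinuousLinearMap.star_eq_adjoint]
  let T := PiLp.continuousLinearEquiv 2 ℝ fun _ : ι => ℝ
  have hderiv (y : EuclideanSpace ℝ ι) : fderiv ℝ (h ∘ T) y (A y) =
      fderiv ℝ h y.ofLp (y i • Pi.single j 1 - y j • Pi.single i 1) := by
    rw [fderiv_comp y (hh.differentiable one_ne_zero _) T.differentiableAt, T.fderiv]
    simp [A, e, T, PiLp.coe_continuousLinearEquiv, EuclideanSpace.inner_single_left]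
  have hcont : Continuous fun y : ι → ℝ =>
      fderiv ℝ h y (y i • Pi.single j 1 - y j • Pi.single i 1) :=
    (hh.continuous_fderiv one_ne_zero).clm_apply (by fun_prop)
  rw [sphereMeasure, integral_map (WithLp.measurable_ofLp ..).aemeasurable
    hcont.aestronglyMeasurable]
  simpa only [hderiv] using integral_uniformSphere_fderiv_skewAdjoint (hh.comp T.contDiff) hA

end Sphere

section Pullback

variable {X Y : Type*} [NormedAddCommGroup X] [NormedSpace ℝ X] [NormedAddCommGroup Y]
  [NormedSpace ℝ Y]

/-- Composition with an analytic map, as a homomorphism of algebras of analytic functions. -/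
def pullback (φ : X → Y) (hφ : ContDiff ℝ ω φ) : AnalyticFunction Y →ₐ[ℂ] AnalyticFunction X where
  toFun f := ⟨fun x => f (φ x), (contDiff_coe f).comp hφ⟩
  map_one' := rfl
  map_mul' _ _ := rfl
  map_zero' := rfl
  map_add' _ _ := rfl
  commutes' _ := rfl

theorem pullback_apply {φ : X → Y} (hφ : ContDiff ℝ ω φ) (f : AnalyticFunction Y) (x : X) :
    pullback φ hφ f x = f (φ x) := rfl

theorem dirDeriv_pullback_apply {φ : X → Y} (hφ : ContDiff ℝ ω φ) (f : AnalyticFunction Y)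
    (v x : X) :
    dirDeriv v (pullback φ hφ f) x = fderiv ℝ ⇑f (φ x) (fderiv ℝ φ x v) := by
  rw [dirDeriv_apply]
  exact congr($(fderiv_comp x (differentiable_coe f _) (hφ.differentiable (by simp) x)) v)

/-- A continuous real linear form, as an analytic function. -/
def linearForm (ℓ : X →L[ℝ] ℝ) : AnalyticFunction X :=
  ⟨fun x => ℓ x, (Complex.ofRealCLM.comp ℓ).contDiff (n := ω)⟩

theorem linearForm_apply (ℓ : X →L[ℝ] ℝ) (x : X) : linearForm ℓ x = ℓ x := rfl

theorem dirDeriv_linearForm (v : X) (ℓ : X →L[ℝ] ℝ) :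
    dirDeriv v (linearForm ℓ) = algebraMap ℂ _ (ℓ v : ℂ) := by
  ext x
  exact congr($((Complex.ofRealCLM.comp ℓ).fderiv (x := x)) v)

theorem fderiv_coe_eq_sum {ι : Type*} [Fintype ι] [DecidableEq ι] (f : AnalyticFunction (ι → ℝ))
    (x v : ι → ℝ) :
    fderiv ℝ ⇑f x v =
      ∑ j, (v j : ℂ) * dirDeriv (Pi.single j 1) f x := by
  conv_lhs => rw [pi_eq_sum_univ' v, map_sum]
  refine Finset.sum_congr rfl fun j _ => ?_
  rw [map_smul, dirDeriv_apply, Complex.real_smul]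

end Pullback

section SphericalMean

variable {ι : Type*} [Fintype ι] {X : Type*} [NormedAddCommGroup X] [NormedSpace ℝ X]

theorem integrable_sphereMeasure {F : Type*} [NormedAddCommGroup F] {h : (ι → ℝ) → F}
    (hh : Continuous h) : Integrable h (sphereMeasure ι) :=
  integrable_of_continuous (isCompact_closedBall 0 1) ae_sphereMeasure_mem_closedBall hh

/-- The average over the unit sphere in the second variable. -/
def sphereAverage : AnalyticFunction (X × (ι → ℝ)) →ₗ[ℂ] AnalyticFunction X where
  toFun f := ⟨fun x => ∫ y, f (x, y) ∂sphereMeasure ι,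
    contDiff_omega_iff_analyticOnNhd.2 (analyticOnNhd_integral (isCompact_closedBall 0 1)
      ae_sphereMeasure_mem_closedBall (analyticOnNhd_coe f))⟩
  map_add' f g := AnalyticFunction.ext fun x => integral_add
    (integrable_sphereMeasure ((contDiff_coe f).continuous.comp (.prodMk_right x)))
    (integrable_sphereMeasure ((contDiff_coe g).continuous.comp (.prodMk_right x)))
  map_smul' c _ := AnalyticFunction.ext fun _ => integral_const_mul c _

theorem sphereAverage_apply (f : AnalyticFunction (X × (ι → ℝ))) (x : X) :
    sphereAverage f x = ∫ y, f (x, y) ∂sphereMeasure ι := rfl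

theorem dirDeriv_sphereAverage [ProperSpace X] (v : X) (f : AnalyticFunction (X × (ι → ℝ))) :
    dirDeriv v (sphereAverage f) = sphereAverage (dirDeriv (v, 0) f) :=
  AnalyticFunction.ext fun x => fderiv_integral_apply (g := ⇑f)
    (isCompact_closedBall 0 1) ae_sphereMeasure_mem_closedBall ((contDiff_coe f).of_le le_top) x v

theorem sphereAverage_pullback_mul (a : AnalyticFunction X) (f : AnalyticFunction (X × (ι → ℝ))) :
    sphereAverage (pullback Prod.fst contDiff_fst a * f) = a * sphereAverage f :=
  AnalyticFunction.ext fun x => integral_const_mul (a x) _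

/-- The `i`-th coordinate of the second variable. -/
def fiberCoord (i : ι) : AnalyticFunction (X × (ι → ℝ)) :=
  linearForm ((ContinuousLinearMap.proj i).comp (.snd ℝ X (ι → ℝ)))

theorem sphereAverage_sum_sq_mul (f : AnalyticFunction (X × (ι → ℝ))) :
    sphereAverage ((∑ i, fiberCoord i ^ 2) * f) = sphereAverage f := by
  ext x
  refine integral_congr_ae ?_
  filter_upwards [ae_sphereMeasure_sum_sq_eq_one (ι := ι)] with y hy
  have hsq : ∑ i, (y i : ℂ) ^ 2 = 1 := by exact_mod_cast hy
  simp [fiberCoord, linearForm_apply, hsq]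

theorem sphereAverage_rotation [DecidableEq ι] (f : AnalyticFunction (X × (ι → ℝ))) (i j : ι) :
    sphereAverage (fiberCoord i * dirDeriv (0, Pi.single j 1) f -
      fiberCoord j * dirDeriv (0, Pi.single i 1) f) = 0 := by
  ext x
  have hh : ContDiff ℝ 1 fun y => f (x, y) :=
    ((contDiff_coe f).of_le le_top).comp (contDiff_const.prodMk contDiff_id)
  have hderiv (y v : ι → ℝ) : dirDeriv (0, v) f (x, y) =
      fderiv ℝ (fun y => f (x, y)) y v :=
    (fderiv_prodMk_right_apply (differentiable_coe f (x, y)) v).symm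
  refine Eq.trans (integral_congr_ae (.of_forall fun y => ?_))
    (integral_sphereMeasure_rotation hh i j)
  simp [hderiv, fiberCoord, linearForm_apply]

theorem dirDeriv_fiberCoord (v : X) (w : ι → ℝ) (i : ι) :
    dirDeriv (v, w) (fiberCoord i) = algebraMap ℂ _ (w i : ℂ) :=
  dirDeriv_linearForm _ _

/-- The function `((t, x), y) ↦ g (x + t y)`. -/
def rayPullback :
    AnalyticFunction (ι → ℝ) →ₐ[ℂ] AnalyticFunction ((ℝ × (ι → ℝ)) × (ι → ℝ)) :=
  pullback (fun p => p.1.2 + p.1.1 • p.2) (by fun_prop)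

/-- The time coordinate on space-time. -/
def timeCoord : AnalyticFunction (ℝ × X) := linearForm (.fst ℝ ℝ X)

theorem dirDeriv_rayPullback_apply (g : AnalyticFunction (ι → ℝ)) (τ : ℝ) (ξ η : ι → ℝ)
    (p : (ℝ × (ι → ℝ)) × (ι → ℝ)) :
    dirDeriv ((τ, ξ), η) (rayPullback g) p =
      fderiv ℝ ⇑g (p.1.2 + p.1.1 • p.2) (ξ + τ • p.2 + p.1.1 • η) := by
  refine (dirDeriv_pullback_apply _ g _ p).trans (congrArg _ ?_)
  have := (hasFDerivAt_fst (𝕜 := ℝ) (p := p)).snd.add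
    ((hasFDerivAt_fst (𝕜 := ℝ) (p := p)).fst.smul hasFDerivAt_snd)
  rw [show fderiv ℝ (fun p : (ℝ × (ι → ℝ)) × (ι → ℝ) => p.1.2 + p.1.1 • p.2) p = _ from
    this.fderiv]
  simp
  abel

/-- The time derivative `∂ₜ` on space-time. -/
abbrev timeDeriv : Derivation ℂ (AnalyticFunction (ℝ × X)) (AnalyticFunction (ℝ × X)) :=
  dirDeriv (1, 0)

/-- The spherical mean `(t, x) ↦ ⨍ g (x + t y)` over unit vectors `y`. -/
def sphericalMean : AnalyticFunction (ι → ℝ) →ₗ[ℂ] AnalyticFunction (ℝ × (ι → ℝ)) :=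
  sphereAverage ∘ₗ rayPullback.toLinearMap

theorem sphericalMean_def (g : AnalyticFunction (ι → ℝ)) :
    sphericalMean g = sphereAverage (rayPullback g) := rfl

/-- Kirchhoff's operator `g ↦ t ⨍ g (x + t y)`. In three space dimensions it solves the wave
equation with initial value `0` and initial velocity `g`. -/
def kirchhoff : AnalyticFunction (ι → ℝ) →ₗ[ℂ] AnalyticFunction (ℝ × (ι → ℝ)) :=
  LinearMap.mulLeft ℂ timeCoord ∘ₗ sphericalMean

theorem timeDeriv_kirchhoff (g : AnalyticFunction (ι → ℝ)) :
    timeDeriv (kirchhoff g) = timeCoord * timeDeriv (sphericalMean g) + sphericalMean g := by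
  simp [kirchhoff, timeCoord, dirDeriv_linearForm]

theorem kirchhoff_zero_apply (g : AnalyticFunction (ι → ℝ)) (x : ι → ℝ) :
    kirchhoff g (0, x) = 0 := by
  simp [kirchhoff, timeCoord, linearForm_apply]

theorem timeDeriv_kirchhoff_zero_apply [Nonempty ι] (g : AnalyticFunction (ι → ℝ)) (x : ι → ℝ) :
    timeDeriv (kirchhoff g) (0, x) = g x := by
  rw [timeDeriv_kirchhoff]
  simp [timeCoord, linearForm_apply, sphericalMean, sphereAverage_apply, rayPullback,
    pullback_apply]

variable [DecidableEq ι]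

/-- The partial derivatives on `ι → ℝ`. -/
abbrev partialDeriv (j : ι) : Derivation ℂ (AnalyticFunction (ι → ℝ)) (AnalyticFunction (ι → ℝ)) :=
  dirDeriv (Pi.single j 1)

/-- The partial derivatives in the space variables of space-time. -/
abbrev spaceDeriv (j : ι) :
    Derivation ℂ (AnalyticFunction (ℝ × (ι → ℝ))) (AnalyticFunction (ℝ × (ι → ℝ))) :=
  dirDeriv (0, Pi.single j 1)

theorem spaceDeriv_rayPullback (g : AnalyticFunction (ι → ℝ)) (j : ι) :
    dirDeriv ((0, Pi.single j 1), 0) (rayPullback g) =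
      rayPullback (partialDeriv j g) := by
  ext p
  rw [dirDeriv_rayPullback_apply]
  simp [rayPullback, pullback_apply, dirDeriv_apply]

theorem fiberDeriv_rayPullback (g : AnalyticFunction (ι → ℝ)) (j : ι) :
    dirDeriv (0, Pi.single j 1) (rayPullback g) =
      pullback Prod.fst contDiff_fst timeCoord * rayPullback (partialDeriv j g) := by
  ext p
  refine (dirDeriv_rayPullback_apply g 0 0 _ p).trans ?_
  simp [rayPullback, pullback_apply, dirDeriv_apply, timeCoord, linearForm_apply]

theorem timeDeriv_rayPullback (g : AnalyticFunction (ι → ℝ)) :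
    dirDeriv ((1, 0), 0) (rayPullback g) =
      ∑ j, fiberCoord j * rayPullback (partialDeriv j g) := by
  ext p
  rw [dirDeriv_rayPullback_apply, fderiv_coe_eq_sum]
  simp [rayPullback, pullback_apply, fiberCoord, linearForm_apply]

theorem spaceDeriv_sphericalMean (g : AnalyticFunction (ι → ℝ)) (j : ι) :
    spaceDeriv j (sphericalMean g) = sphericalMean (partialDeriv j g) := by
  simp [sphericalMean, dirDeriv_sphereAverage, spaceDeriv_rayPullback]

theorem rotation_rayPullback (g : AnalyticFunction (ι → ℝ)) (i j : ι) :
    let G := rayPullback (partialDeriv j g)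
    fiberCoord i * dirDeriv (0, Pi.single j 1) (fiberCoord i * G) -
        fiberCoord j * dirDeriv (0, Pi.single i 1) (fiberCoord i * G) =
      pullback Prod.fst contDiff_fst timeCoord * (fiberCoord i ^ 2 *
        rayPullback (partialDeriv j (partialDeriv j g)) -
        fiberCoord j * fiberCoord i *
          rayPullback (partialDeriv i (partialDeriv j g))) -
      (1 - if i = j then 1 else 0) * (fiberCoord j * G) := by
  simp only [Derivation.leibniz, dirDeriv_fiberCoord, fiberDeriv_rayPullback, smul_eq_mul]
  by_cases h : i = j
  · subst h; simp; ring
  · simp [h, Pi.single_eq_of_ne]; ring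

theorem timeDeriv_timeDeriv_rayPullback (g : AnalyticFunction (ι → ℝ)) :
    dirDeriv ((1, 0), 0) (dirDeriv ((1, 0), 0) (rayPullback g)) =
      ∑ i, ∑ j, fiberCoord j * fiberCoord i *
        rayPullback (partialDeriv i (partialDeriv j g)) := by
  simp only [timeDeriv_rayPullback, map_sum, Derivation.leibniz, dirDeriv_fiberCoord, smul_eq_mul,
    Pi.zero_apply, Complex.ofReal_zero, map_zero, mul_zero, add_zero, Finset.mul_sum]
  rw [Finset.sum_comm]
  simp only [mul_assoc]

theorem sum_rotation_rayPullback (g : AnalyticFunction (ι → ℝ)) :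
    ∑ i, ∑ j, (fiberCoord i * dirDeriv (0, Pi.single j 1)
          (fiberCoord i * rayPullback (partialDeriv j g)) -
        fiberCoord j * dirDeriv (0, Pi.single i 1)
          (fiberCoord i * rayPullback (partialDeriv j g))) =
      pullback Prod.fst contDiff_fst timeCoord * ((∑ i, fiberCoord i ^ 2) *
          rayPullback (laplacian partialDeriv g) -
        dirDeriv ((1, 0), 0) (dirDeriv ((1, 0), 0) (rayPullback g))) -
      pullback Prod.fst contDiff_fst ((Fintype.card ι : AnalyticFunction (ℝ × (ι → ℝ))) - 1) *
        dirDeriv ((1, 0), 0) (rayPullback g) := by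
  have hdiag : ∑ i : ι, ∑ j, (1 - if i = j then 1 else 0) * (fiberCoord j *
        rayPullback (partialDeriv j g)) =
      ((Fintype.card ι : AnalyticFunction ((ℝ × (ι → ℝ)) × (ι → ℝ))) - 1) *
        dirDeriv ((1, 0), 0) (rayPullback g) := by
    rw [Finset.sum_comm]
    simp [← Finset.sum_mul, ← Finset.mul_sum, timeDeriv_rayPullback]
  simp only [rotation_rayPullback, Finset.sum_sub_distrib, ← Finset.mul_sum, hdiag,
    timeDeriv_timeDeriv_rayPullback, laplacian, map_sum, map_sub, map_natCast, map_one,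
    ← Finset.sum_mul]

theorem darboux_sphericalMean (g : AnalyticFunction (ι → ℝ)) :
    timeCoord * timeDeriv (timeDeriv (sphericalMean g)) +
        ((Fintype.card ι : AnalyticFunction (ℝ × (ι → ℝ))) - 1) *
          timeDeriv (sphericalMean g) =
      timeCoord * laplacian spaceDeriv (sphericalMean g) := by
  have hsum := congrArg sphereAverage (sum_rotation_rayPullback g)
  simp only [map_sum, sphereAverage_rotation, Finset.sum_const_zero] at hsum
  rw [map_sub, sphereAverage_pullback_mul, sphereAverage_pullback_mul, map_sub,
    sphereAverage_sum_sq_mul, ← dirDeriv_sphereAverage,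
    ← dirDeriv_sphereAverage] at hsum
  have hΔ : laplacian spaceDeriv (sphericalMean g) =
      sphericalMean (laplacian partialDeriv g) := by
    rw [laplacian, laplacian, map_sum]
    exact Finset.sum_congr rfl fun j _ => by
      rw [spaceDeriv_sphericalMean, spaceDeriv_sphericalMean]
  simp only [← sphericalMean_def] at hsum
  rw [hΔ]
  linear_combination hsum

theorem spaceDeriv_kirchhoff (g : AnalyticFunction (ι → ℝ)) (j : ι) :
    spaceDeriv j (kirchhoff g) = kirchhoff (partialDeriv j g) := by
  simp [kirchhoff, spaceDeriv_sphericalMean, timeCoord, dirDeriv_linearForm]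

theorem box_kirchhoff (hι : Fintype.card ι = 3) (g : AnalyticFunction (ι → ℝ)) :
    box timeDeriv spaceDeriv (kirchhoff g) = 0 := by
  have hdarboux := darboux_sphericalMean g
  have hΔ : laplacian spaceDeriv (kirchhoff g) =
      timeCoord * laplacian spaceDeriv (sphericalMean g) := by
    rw [laplacian, laplacian, Finset.mul_sum]
    exact Finset.sum_congr rfl fun j _ => by
      rw [spaceDeriv_kirchhoff, spaceDeriv_kirchhoff, spaceDeriv_sphericalMean,
        spaceDeriv_sphericalMean]
      rfl
  have htt : timeDeriv (timeDeriv (kirchhoff g)) =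
      timeCoord * timeDeriv (timeDeriv (sphericalMean g)) + 2 * timeDeriv (sphericalMean g) := by
    rw [timeDeriv_kirchhoff]
    simp [timeCoord, dirDeriv_linearForm]
    ring
  rw [hι, Nat.cast_ofNat] at hdarboux
  rw [box, htt, hΔ]
  linear_combination hdarboux

end SphericalMean

theorem exists_isRiemannSilberstein {f : Fin 3 → AnalyticFunction Vec3}
    (hf : div partialDeriv f = 0) :
    ∃ F : Fin 3 → AnalyticFunction (ℝ × Vec3), IsRiemannSilberstein timeDeriv spaceDeriv F ∧
      ∀ i x, F i (0, x) = f i x := by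
  have hdiv : div spaceDeriv (fun i => kirchhoff (f i)) = 0 := by
    simp only [div, spaceDeriv_kirchhoff, ← map_sum]
    exact (congrArg kirchhoff hf).trans (map_zero _)
  refine ⟨_, isRiemannSilberstein_of_box_eq_zero (fun _ _ => dirDeriv_comm _ _)
    (fun _ => dirDeriv_comm _ _) (fun i => box_kirchhoff rfl (f i)) hdiv, fun i x => ?_⟩
  simp [rot, spaceDeriv_kirchhoff, kirchhoff_zero_apply, timeDeriv_kirchhoff_zero_apply]

section ConservationLaw

theorem setIntegral_fderiv_eq_zero {X V : Type*} [NormedAddCommGroup X] [NormedSpace ℝ X]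
    [NormedAddCommGroup V] [NormedSpace ℝ V] [FiniteDimensional ℝ V] [MeasurableSpace V]
    [BorelSpace V] (μ : Measure V) [μ.IsAddHaarMeasure] {g : X × V → ℝ} (hg : ContDiff ℝ 1 g)
    {K : Set V} (hK : IsCompact K) (a : X) (hs : ∀ x ∉ K, g (a, x) = 0) (v : V) :
    ∫ x in K, fderiv ℝ g (a, x) (0, v) ∂μ = 0 := by
  have hga : ContDiff ℝ 1 fun x => g (a, x) := by fun_prop
  have hcs : HasCompactSupport fun x => g (a, x) := .intro hK hs
  have hd : Continuous fun x => fderiv ℝ (fun x => g (a, x)) x v :=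
    (hga.continuous_fderiv one_ne_zero).clm_apply continuous_const
  have hout : ∀ x ∉ K, fderiv ℝ (fun x => g (a, x)) x v = 0 := fun x hx => by
    have : (fun x => g (a, x)) =ᶠ[𝓝 x] fun _ => 0 :=
      eventually_of_mem (hK.isClosed.isOpen_compl.mem_nhds hx) hs
    simp [this.fderiv_eq]
  simp only [← fderiv_prodMk_right_apply (hg.differentiable one_ne_zero (a, _))]
  rw [setIntegral_eq_integral_of_forall_compl_eq_zero hout]
  simpa using integral_mul_fderiv_eq_neg_fderiv_mul_of_integrable (μ := μ) (v := v)
    (f := fun _ => (1 : ℝ)) (by simp)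
    (by simpa using hd.integrable_of_hasCompactSupport (hcs.fderiv_apply (𝕜 := ℝ) v))
    (by simpa using hga.continuous.integrable_of_hasCompactSupport hcs)
    (fun _ _ => differentiableAt_const 1) (fun x _ => hga.differentiable one_ne_zero x)

variable {ι : Type*} [Fintype ι]

/-- A smooth exhaustion of `ι → ℝ` with partial derivatives bounded by `1`; it replaces the
distance to the origin in the definition of the domains of dependence. -/
def smoothNorm (x : ι → ℝ) : ℝ := √(1 + x ⬝ᵥ x)

theorem dotProduct_self_nonneg (x : ι → ℝ) : 0 ≤ x ⬝ᵥ x :=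
  Finset.sum_nonneg fun i _ => mul_self_nonneg (x i)

theorem one_add_dotProduct_self_pos (x : ι → ℝ) : 0 < 1 + x ⬝ᵥ x :=
  add_pos_of_pos_of_nonneg one_pos (dotProduct_self_nonneg x)

theorem smoothNorm_pos (x : ι → ℝ) : 0 < smoothNorm x :=
  Real.sqrt_pos.2 (one_add_dotProduct_self_pos x)

theorem abs_apply_le_smoothNorm (x : ι → ℝ) (i : ι) : |x i| ≤ smoothNorm x := by
  have := Finset.single_le_sum (fun i _ => mul_self_nonneg (x i)) (Finset.mem_univ i)
  refine Real.abs_le_sqrt ?_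
  rw [dotProduct]
  linarith [sq (x i)]

theorem norm_le_smoothNorm (x : ι → ℝ) : ‖x‖ ≤ smoothNorm x :=
  (pi_norm_le_iff_of_nonneg (smoothNorm_pos x).le).2 (abs_apply_le_smoothNorm x)

theorem contDiff_smoothNorm : ContDiff ℝ 1 (smoothNorm (ι := ι)) :=
  ContDiff.sqrt (by unfold dotProduct; fun_prop) fun x => (one_add_dotProduct_self_pos x).ne'

theorem fderiv_smoothNorm_apply (x v : ι → ℝ) :
    fderiv ℝ smoothNorm x v = (x ⬝ᵥ v) / smoothNorm x := by
  have hsq : HasFDerivAt (fun x : ι → ℝ => 1 + x ⬝ᵥ x) _ x :=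
    (HasFDerivAt.fun_sum fun i _ => (hasFDerivAt_apply (𝕜 := ℝ) i x).mul
      (hasFDerivAt_apply i x)).const_add 1
  have h := (hsq.sqrt (one_add_dotProduct_self_pos x).ne').fderiv
  refine (congrArg (· v) h).trans ?_
  simp [dotProduct, Finset.sum_add_distrib, smoothNorm]
  field

theorem abs_fderiv_smoothNorm_single_le [DecidableEq ι] (x : ι → ℝ) (j : ι) :
    |fderiv ℝ smoothNorm x (Pi.single j 1)| ≤ 1 := by
  rw [fderiv_smoothNorm_apply, dotProduct_single_one, abs_div, abs_of_pos (smoothNorm_pos x)]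
  exact div_le_one_of_le₀ (abs_apply_le_smoothNorm x j) (smoothNorm_pos x).le

/-- A `C¹` cut-off, positive exactly on the cone `c t + smoothNorm x < R`. -/
def coneWeight (R c : ℝ) (p : ℝ × (ι → ℝ)) : ℝ :=
  expNegInvGlue (R - c * p.1 - smoothNorm p.2)

theorem contDiff_coneWeight (R c : ℝ) : ContDiff ℝ 1 (coneWeight (ι := ι) R c) :=
  expNegInvGlue.contDiff.comp
    ((contDiff_const.sub (contDiff_const.mul contDiff_fst)).sub
      (contDiff_smoothNorm.comp contDiff_snd))

theorem fderiv_coneWeight_apply (R c : ℝ) (p v : ℝ × (ι → ℝ)) :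
    fderiv ℝ (coneWeight R c) p v = -(deriv expNegInvGlue (R - c * p.1 - smoothNorm p.2) *
      (c * v.1 + fderiv ℝ smoothNorm p.2 v.2)) := by
  have hnorm := (contDiff_smoothNorm.differentiable one_ne_zero p.2).hasFDerivAt.comp p
    (hasFDerivAt_snd (𝕜 := ℝ) (E := ℝ))
  have hphase := ((hasFDerivAt_fst.const_mul c).const_sub R).sub hnorm
  have hglue := ((expNegInvGlue.contDiff (n := 1)).differentiable one_ne_zero
    (R - c * p.1 - smoothNorm p.2)).hasDerivAt
  refine (congrArg (· v) (hglue.comp_hasFDerivAt p hphase).fderiv).trans ?_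
  simp
  ring

theorem coneWeight_eq_zero {R c : ℝ} {p : ℝ × (ι → ℝ)} (ht : 0 ≤ c * p.1)
    (hx : p.2 ∉ Metric.closedBall 0 R) : coneWeight R c p = 0 := by
  rw [mem_closedBall_zero_iff, not_le] at hx
  exact expNegInvGlue.zero_of_nonpos (by linarith [norm_le_smoothNorm p.2])

variable [DecidableEq ι] {e : ℝ × (ι → ℝ) → ℝ} {S : ℝ × (ι → ℝ) → ι → ℝ} {c : ℝ}

theorem coneWeight_mul_flux_le (he : ContDiff ℝ 1 e) (hS : ContDiff ℝ 1 S)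
    (hcons : ∀ p, fderiv ℝ e p (1, 0) + ∑ j, fderiv ℝ S p (0, Pi.single j 1) j = 0)
    (hflux : ∀ p, ∑ j, |S p j| ≤ c * e p) (R : ℝ) (p : ℝ × (ι → ℝ)) :
    fderiv ℝ (fun p => coneWeight R c p * e p) p (1, 0) +
      ∑ j, fderiv ℝ (fun p => coneWeight R c p * S p j) p (0, Pi.single j 1) ≤ 0 := by
  have hw := (contDiff_coneWeight R c).differentiable one_ne_zero p
  have hSj (j : ι) : HasFDerivAt (fun p => S p j) _ p :=
    hasFDerivAt_pi'.1 (hS.differentiable one_ne_zero p).hasFDerivAt j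
  set d := deriv expNegInvGlue (R - c * p.1 - smoothNorm p.2)
  have hd : 0 ≤ d := expNegInvGlue.monotone.deriv_nonneg
  have hleak : -∑ j, fderiv ℝ smoothNorm p.2 (Pi.single j 1) * S p j ≤ c * e p := by
    refine (neg_le_abs _).trans ((Finset.abs_sum_le_sum_abs _ _).trans (le_trans ?_ (hflux p)))
    refine Finset.sum_le_sum fun j _ => ?_
    rw [abs_mul]
    exact mul_le_of_le_one_left (abs_nonneg _) (abs_fderiv_smoothNorm_single_le p.2 j)
  have key : fderiv ℝ (fun p => coneWeight R c p * e p) p (1, 0) +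
      ∑ j, fderiv ℝ (fun p => coneWeight R c p * S p j) p (0, Pi.single j 1) =
      coneWeight R c p * (fderiv ℝ e p (1, 0) + ∑ j, fderiv ℝ S p (0, Pi.single j 1) j) -
      d * (c * e p + ∑ j, fderiv ℝ smoothNorm p.2 (Pi.single j 1) * S p j) := by
    simp only [fderiv_fun_mul hw (he.differentiable one_ne_zero p),
      fun j => fderiv_fun_mul hw (hSj j).differentiableAt, fun j => (hSj j).fderiv,
      add_apply, smul_apply, smul_eq_mul,
      fderiv_coneWeight_apply, Finset.sum_add_distrib, mul_add, Finset.mul_sum]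
    simp [d, Finset.sum_neg_distrib, mul_comm, mul_left_comm]
    ring
  rw [key, hcons, mul_zero, zero_sub, neg_nonpos]
  exact mul_nonneg hd (by linarith)

theorem antitoneOn_integral_coneWeight_mul (he : ContDiff ℝ 1 e) (hS : ContDiff ℝ 1 S)
    (hcons : ∀ p, fderiv ℝ e p (1, 0) + ∑ j, fderiv ℝ S p (0, Pi.single j 1) j = 0)
    (hc : 0 ≤ c) (hflux : ∀ p, ∑ j, |S p j| ≤ c * e p) (R : ℝ) :
    AntitoneOn (fun t => ∫ x in Metric.closedBall 0 R, coneWeight R c (t, x) * e (t, x))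
      (Ici 0) := by
  have hK : IsCompact (Metric.closedBall (0 : ι → ℝ) R) := isCompact_closedBall 0 R
  have hμ := ae_restrict_mem (μ := volume) hK.measurableSet
  have : IsFiniteMeasure (volume.restrict (Metric.closedBall (0 : ι → ℝ) R)) :=
    isFiniteMeasure_restrict.2 hK.measure_ne_top
  have hw := contDiff_coneWeight (ι := ι) R c
  have hE : ContDiff ℝ 1 fun p => coneWeight R c p * e p := hw.mul he
  have hP (j : ι) : ContDiff ℝ 1 fun p => coneWeight R c p * S p j :=
    hw.mul (contDiff_pi.1 hS j)
  have hint {g : ℝ × (ι → ℝ) → ℝ} (hg : ContDiff ℝ 1 g) (t : ℝ) (v : ℝ × (ι → ℝ)) :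
      IntegrableOn (fun x => fderiv ℝ g (t, x) v) (Metric.closedBall 0 R) :=
    integrable_of_continuous hK hμ <| ((hg.continuous_fderiv one_ne_zero).clm_apply
      continuous_const).comp (.prodMk_right t)
  have hdiff : Differentiable ℝ fun t =>
      ∫ x in Metric.closedBall 0 R, coneWeight R c (t, x) * e (t, x) :=
    fun t => (hasFDerivAt_integral hK hμ hE t).differentiableAt
  refine antitoneOn_of_deriv_nonpos (convex_Ici 0) hdiff.continuous.continuousOn
    hdiff.differentiableOn fun t ht => ?_
  rw [interior_Ici] at ht
  have hzero : ∫ x in Metric.closedBall 0 R,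
      ∑ j, fderiv ℝ (fun p => coneWeight R c p * S p j) (t, x) (0, Pi.single j 1) = 0 := by
    rw [integral_finsetSum _ fun j _ => hint (hP j) t _]
    exact Finset.sum_eq_zero fun j _ => setIntegral_fderiv_eq_zero volume (hP j) hK t
      (fun x hx => by rw [coneWeight_eq_zero (mul_nonneg hc ht.le) hx, zero_mul]) _
  rw [← fderiv_apply_one_eq_deriv, fderiv_integral_apply hK hμ hE]
  refine (add_zero (∫ x in Metric.closedBall 0 R, _)).symm.trans_le ?_
  rw (occs := .pos [1]) [← hzero]
  rw [← integral_add (hint hE t _) (integrable_finsetSum _ fun j _ => hint (hP j) t _)]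
  exact integral_nonpos fun x => coneWeight_mul_flux_le he hS hcons hflux R (t, x)

theorem eq_zero_of_conservation_law_of_nonneg (he : ContDiff ℝ 1 e) (hS : ContDiff ℝ 1 S)
    (hcons : ∀ p, fderiv ℝ e p (1, 0) + ∑ j, fderiv ℝ S p (0, Pi.single j 1) j = 0)
    (hc : 0 ≤ c) (hflux : ∀ p, ∑ j, |S p j| ≤ c * e p) (hnonneg : ∀ p, 0 ≤ e p)
    (hzero : ∀ x, e (0, x) = 0) {t : ℝ} (ht : 0 ≤ t) (x : ι → ℝ) : e (t, x) = 0 := by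
  set R := c * t + smoothNorm x + 1
  have hwe_nonneg (y : ι → ℝ) : 0 ≤ coneWeight R c (t, y) * e (t, y) :=
    mul_nonneg (expNegInvGlue.nonneg _) (hnonneg _)
  have hwe_out : ∀ y ∉ Metric.closedBall 0 R, coneWeight R c (t, y) * e (t, y) = 0 :=
    fun y hy => by rw [coneWeight_eq_zero (mul_nonneg hc ht) hy, zero_mul]
  have hwe_cont : Continuous fun y => coneWeight R c (t, y) * e (t, y) :=
    ((contDiff_coneWeight R c).mul he).continuous.comp (.prodMk_right t)
  have hint : ∫ y, coneWeight R c (t, y) * e (t, y) ≤ 0 := by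
    rw [← setIntegral_eq_integral_of_forall_compl_eq_zero hwe_out]
    simpa [hzero] using
      antitoneOn_integral_coneWeight_mul he hS hcons hc hflux R self_mem_Ici ht ht
  have hwe : coneWeight R c (t, x) * e (t, x) = 0 := by
    by_contra hne
    exact hint.not_gt (hwe_cont.integral_pos_of_hasCompactSupport_nonneg_nonzero
      (.intro (isCompact_closedBall 0 R) hwe_out) hwe_nonneg hne)
  refine (mul_eq_zero.1 hwe).resolve_left (expNegInvGlue.pos_of_pos ?_).ne'
  linarith

theorem eq_zero_of_conservation_law (he : ContDiff ℝ 1 e) (hS : ContDiff ℝ 1 S)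
    (hcons : ∀ p, fderiv ℝ e p (1, 0) + ∑ j, fderiv ℝ S p (0, Pi.single j 1) j = 0)
    (hc : 0 ≤ c) (hflux : ∀ p, ∑ j, |S p j| ≤ c * e p) (hnonneg : ∀ p, 0 ≤ e p)
    (hzero : ∀ x, e (0, x) = 0) (p : ℝ × (ι → ℝ)) : e p = 0 := by
  obtain ⟨t, x⟩ := p
  rcases le_total 0 t with ht | ht
  · exact eq_zero_of_conservation_law_of_nonneg he hS hcons hc hflux hnonneg hzero ht x
  let ρ : ℝ × (ι → ℝ) →L[ℝ] ℝ × (ι → ℝ) :=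
    (-ContinuousLinearMap.fst ℝ ℝ (ι → ℝ)).prod (.snd ℝ ℝ (ι → ℝ))
  have := eq_zero_of_conservation_law_of_nonneg (e := fun p => e (ρ p)) (S := fun p => -S (ρ p))
    (he.comp ρ.contDiff) (hS.comp ρ.contDiff).neg (fun p => ?_) hc
    (fun p => by simpa using hflux (ρ p)) (fun p => hnonneg (ρ p))
    (fun x => by simpa [ρ] using hzero x) (neg_nonneg.2 ht) x
  · simpa [ρ] using this
  · have hreflect : fderiv ℝ e (ρ p) (ρ (1, 0)) = -fderiv ℝ e (ρ p) (1, 0) := by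
      rw [← map_neg]
      simp [ρ]
    rw [fderiv_fun_neg, fderiv_fun_comp p (he.differentiable one_ne_zero _) ρ.differentiableAt,
      fderiv_fun_comp p (hS.differentiable one_ne_zero _) ρ.differentiableAt, ρ.fderiv]
    simp only [neg_apply, Pi.neg_apply, ContinuousLinearMap.comp_apply, hreflect,
      Finset.sum_neg_distrib, ← neg_add]
    exact neg_eq_zero.2 (by simpa [ρ] using hcons (ρ p))

end ConservationLaw

section VectorCalculus

theorem fderiv_dotProduct_apply {G : Type*} [NormedAddCommGroup G] [NormedSpace ℝ G]
    {X Y : G → Vec3} {p : G} (hX : DifferentiableAt ℝ X p) (hY : DifferentiableAt ℝ Y p) (v : G) :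
    fderiv ℝ (fun q => X q ⬝ᵥ Y q) p v = X p ⬝ᵥ fderiv ℝ Y p v + fderiv ℝ X p v ⬝ᵥ Y p :=
  congr($((ContinuousLinearMap.hasFDerivAt_of_bilinear
    (dotProductBilin ℝ ℝ : Vec3 →ₗ[ℝ] Vec3 →ₗ[ℝ] ℝ).toContinuousBilinearMap
      hX.hasFDerivAt hY.hasFDerivAt).fderiv) v)

theorem fderiv_crossProduct_apply {G : Type*} [NormedAddCommGroup G] [NormedSpace ℝ G]
    {X Y : G → Vec3} {p : G} (hX : DifferentiableAt ℝ X p) (hY : DifferentiableAt ℝ Y p) (v : G) :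
    fderiv ℝ (fun q => X q ⨯₃ Y q) p v = X p ⨯₃ fderiv ℝ Y p v + fderiv ℝ X p v ⨯₃ Y p :=
  congr($((ContinuousLinearMap.hasFDerivAt_of_bilinear
    (crossProduct (R := ℝ)).toContinuousBilinearMap hX.hasFDerivAt hY.hasFDerivAt).fderiv) v)

variable {X Y : Vec3 → Vec3} {x : Vec3}

theorem pderiv_sub (hX : DifferentiableAt ℝ X x) (hY : DifferentiableAt ℝ Y x) (j i : Fin 3) :
    pderiv (X - Y) j i x = pderiv X j i x - pderiv Y j i x := by
  simp [pderiv, fderiv_sub hX hY]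

theorem curl_apply (X : Vec3 → Vec3) (x : Vec3) (i : Fin 3) :
    curl X x i = pderiv X (i + 1) (i + 2) x - pderiv X (i + 2) (i + 1) x := by
  fin_cases i <;> rfl

theorem curl_sub (hX : DifferentiableAt ℝ X x) (hY : DifferentiableAt ℝ Y x) :
    curl (X - Y) x = curl X x - curl Y x := by
  ext i
  simp only [curl_apply, pderiv_sub hX hY, Pi.sub_apply]
  ring

theorem divergence_sub (hX : DifferentiableAt ℝ X x) (hY : DifferentiableAt ℝ Y x) :
    divergence (X - Y) x = divergence X x - divergence Y x := by
  simp [divergence, pderiv_sub hX hY]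

theorem divergence_crossProduct (hX : DifferentiableAt ℝ X x) (hY : DifferentiableAt ℝ Y x) :
    divergence (fun y => X y ⨯₃ Y y) x = curl X x ⬝ᵥ Y x - X x ⬝ᵥ curl Y x := by
  simp only [divergence, pderiv, fderiv_crossProduct_apply hX hY]
  simp only [curl, pderiv, Pi.add_apply, cross_apply, Matrix.vec3_dotProduct, Fin.sum_univ_three,
    Matrix.cons_val]
  ring

end VectorCalculus

section Uniqueness

variable {E B E' B' : ℝ → Vec3 → Vec3}

theorem energyDensity_nonneg (X Y : Vec3 → Vec3) (x : Vec3) : 0 ≤ energyDensity X Y x :=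
  div_nonneg (add_nonneg (dotProduct_self_nonneg _) (dotProduct_self_nonneg _)) zero_le_two

theorem energyDensity_eq_zero_iff {X Y : Vec3 → Vec3} {x : Vec3} :
    energyDensity X Y x = 0 ↔ X x = 0 ∧ Y x = 0 := by
  rw [energyDensity, div_eq_zero_iff, or_iff_left two_ne_zero, add_eq_zero_iff_of_nonneg
    (dotProduct_self_nonneg _) (dotProduct_self_nonneg _), dotProduct_self_eq_zero,
    dotProduct_self_eq_zero]

theorem sum_abs_crossProduct_le (a b : Vec3) :
    ∑ j, |(a ⨯₃ b) j| ≤ 3 * ((a ⬝ᵥ a + b ⬝ᵥ b) / 2) := by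
  have hterm (p q r s : ℝ) : |p * q - r * s| ≤ (p * p + r * r + (q * q + s * s)) / 2 :=
    abs_le.2 ⟨by nlinarith [sq_nonneg (p + q), sq_nonneg (r - s)],
      by nlinarith [sq_nonneg (p - q), sq_nonneg (r + s)]⟩
  simp only [Fin.sum_univ_three, cross_apply, Matrix.vec3_dotProduct, Matrix.cons_val]
  linarith [hterm (a 1) (b 2) (a 2) (b 1), hterm (a 2) (b 0) (a 0) (b 2),
    hterm (a 0) (b 1) (a 1) (b 0), mul_self_nonneg (a 0), mul_self_nonneg (a 1),
    mul_self_nonneg (a 2), mul_self_nonneg (b 0), mul_self_nonneg (b 1), mul_self_nonneg (b 2)]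

namespace IsMaxwellSolution

theorem contDiff_E_apply (h : IsMaxwellSolution E B) (t : ℝ) : ContDiff ℝ 1 (E t) :=
  h.contDiff_E.comp (contDiff_prodMk_right t)

theorem contDiff_B_apply (h : IsMaxwellSolution E B) (t : ℝ) : ContDiff ℝ 1 (B t) :=
  h.contDiff_B.comp (contDiff_prodMk_right t)

theorem differentiableAt_E_time (h : IsMaxwellSolution E B) (t : ℝ) (x : Vec3) :
    DifferentiableAt ℝ (fun s => E s x) t :=
  (h.contDiff_E.comp (contDiff_prodMk_left x)).differentiable one_ne_zero t

theorem differentiableAt_B_time (h : IsMaxwellSolution E B) (t : ℝ) (x : Vec3) :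
    DifferentiableAt ℝ (fun s => B s x) t :=
  (h.contDiff_B.comp (contDiff_prodMk_left x)).differentiable one_ne_zero t

theorem poynting (h : IsMaxwellSolution E B) (p : ℝ × Vec3) :
    fderiv ℝ (fun q : ℝ × Vec3 => energyDensity (E q.1) (B q.1) q.2) p (1, 0) +
      ∑ j, fderiv ℝ (fun q : ℝ × Vec3 => E q.1 q.2 ⨯₃ B q.1 q.2) p (0, Pi.single j 1) j = 0 := by
  obtain ⟨t, x⟩ := p
  have hE := h.contDiff_E.differentiable one_ne_zero (t, x)
  have hB := h.contDiff_B.differentiable one_ne_zero (t, x)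
  have hEt := (h.contDiff_E_apply t).differentiable one_ne_zero x
  have hBt := (h.contDiff_B_apply t).differentiable one_ne_zero x
  have hflux : ∑ j, fderiv ℝ (fun q : ℝ × Vec3 => E q.1 q.2 ⨯₃ B q.1 q.2) (t, x)
      (0, Pi.single j 1) j = curl (E t) x ⬝ᵥ B t x - E t x ⬝ᵥ curl (B t) x := by
    simp only [← divergence_crossProduct hEt hBt, divergence, pderiv,
      fderiv_crossProduct_apply hE hB, fderiv_crossProduct_apply hEt hBt,
      ← fderiv_prodMk_right_apply hE, ← fderiv_prodMk_right_apply hB]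
  have henergy : fderiv ℝ (fun q : ℝ × Vec3 => energyDensity (E q.1) (B q.1) q.2) (t, x) (1, 0) =
      E t x ⬝ᵥ curl (B t) x - curl (E t) x ⬝ᵥ B t x := by
    have hdotE : DifferentiableAt ℝ (fun q : ℝ × Vec3 => E q.1 q.2 ⬝ᵥ E q.1 q.2) (t, x) := by
      unfold dotProduct; fun_prop
    have hdotB : DifferentiableAt ℝ (fun q : ℝ × Vec3 => B q.1 q.2 ⬝ᵥ B q.1 q.2) (t, x) := by
      unfold dotProduct; fun_prop
    simp only [energyDensity, div_eq_mul_inv]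
    rw [fderiv_mul_const (hdotE.fun_add hdotB), fderiv_fun_add hdotE hdotB]
    simp only [smul_apply, add_apply,
      fderiv_dotProduct_apply hE hE, fderiv_dotProduct_apply hB hB, ← deriv_prodMk_left hE,
      ← deriv_prodMk_left hB, h.ampere, h.faraday, dotProduct_comm (curl _ _), smul_eq_mul,
      neg_dotProduct, dotProduct_neg]
    rw [dotProduct_comm (B t x)]
    ring
  rw [hflux, henergy]
  ring

theorem sub (h : IsMaxwellSolution E B) (h' : IsMaxwellSolution E' B') :
    IsMaxwellSolution (E - E') (B - B') where
  contDiff_E := h.contDiff_E.sub h'.contDiff_E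
  contDiff_B := h.contDiff_B.sub h'.contDiff_B
  ampere t x := by
    simp only [Pi.sub_apply, curl_sub ((h.contDiff_B_apply t).differentiable one_ne_zero x)
      ((h'.contDiff_B_apply t).differentiable one_ne_zero x), ← h.ampere, ← h'.ampere]
    exact deriv_fun_sub (h.differentiableAt_E_time t x) (h'.differentiableAt_E_time t x)
  faraday t x := by
    simp only [Pi.sub_apply, curl_sub ((h.contDiff_E_apply t).differentiable one_ne_zero x)
      ((h'.contDiff_E_apply t).differentiable one_ne_zero x), neg_sub', ← h.faraday, ← h'.faraday]
    exact deriv_fun_sub (h.differentiableAt_B_time t x) (h'.differentiableAt_B_time t x)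
  gauss_E t x := by
    simp [divergence_sub ((h.contDiff_E_apply t).differentiable one_ne_zero x)
      ((h'.contDiff_E_apply t).differentiable one_ne_zero x), h.gauss_E, h'.gauss_E]
  gauss_B t x := by
    simp [divergence_sub ((h.contDiff_B_apply t).differentiable one_ne_zero x)
      ((h'.contDiff_B_apply t).differentiable one_ne_zero x), h.gauss_B, h'.gauss_B]

theorem eq_zero (h : IsMaxwellSolution E B) (hE : E 0 = 0) (hB : B 0 = 0) : E = 0 ∧ B = 0 := by
  have hcontE := h.contDiff_E
  have hcontB := h.contDiff_B
  have hcontEnergy : ContDiff ℝ 1 fun p : ℝ × Vec3 => energyDensity (E p.1) (B p.1) p.2 := by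
    unfold energyDensity dotProduct; fun_prop
  have hcontFlux : ContDiff ℝ 1 fun p : ℝ × Vec3 => E p.1 p.2 ⨯₃ B p.1 p.2 :=
    (crossProduct (R := ℝ)).toContinuousBilinearMap.isBoundedBilinearMap.contDiff.comp
      (hcontE.prodMk hcontB)
  have henergy (t : ℝ) (x : Vec3) : energyDensity (E t) (B t) x = 0 :=
    eq_zero_of_conservation_law hcontEnergy hcontFlux h.poynting (c := 3) (by norm_num)
      (fun p => sum_abs_crossProduct_le _ _) (fun p => energyDensity_nonneg _ _ _)
      (fun x => by simp [energyDensity, hE, hB]) (t, x)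
  exact ⟨funext₂ fun t x => (energyDensity_eq_zero_iff.1 (henergy t x)).1,
    funext₂ fun t x => (energyDensity_eq_zero_iff.1 (henergy t x)).2⟩

theorem ext (h : IsMaxwellSolution E B) (h' : IsMaxwellSolution E' B') (hE : E 0 = E' 0)
    (hB : B 0 = B' 0) : E = E' ∧ B = B' := by
  obtain ⟨hE, hB⟩ := (h.sub h').eq_zero (sub_eq_zero.2 hE) (sub_eq_zero.2 hB)
  exact ⟨sub_eq_zero.1 hE, sub_eq_zero.1 hB⟩

end IsMaxwellSolution

end Uniqueness

section RealAndImaginaryParts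

variable {X : Type*} [NormedAddCommGroup X] [NormedSpace ℝ X] (ℓ : ℂ →L[ℝ] ℝ)

/-- The real vector field obtained from a complex one by applying `ℓ` to each component; the cases
of interest are the real part and the imaginary part. -/
def mapField (F : Fin 3 → AnalyticFunction X) (x : X) : Vec3 := fun i => ℓ (F i x)

theorem contDiff_mapField (F : Fin 3 → AnalyticFunction X) : ContDiff ℝ ω (mapField ℓ F) :=
  contDiff_pi.2 fun i => ℓ.contDiff.comp (contDiff_coe (F i))

theorem fderiv_mapField_apply (F : Fin 3 → AnalyticFunction X) (x v : X) :
    fderiv ℝ (mapField ℓ F) x v = mapField ℓ (fun i => dirDeriv v (F i)) x :=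
  congr($((hasFDerivAt_pi.2 fun i =>
    ℓ.hasFDerivAt.comp x (differentiable_coe (F i) x).hasFDerivAt).fderiv) v)

theorem divergence_mapField (f : Fin 3 → AnalyticFunction Vec3) (x : Vec3) :
    divergence (mapField ℓ f) x = ℓ (div partialDeriv f x) := by
  simp [divergence, pderiv, fderiv_mapField_apply, div, mapField]

variable (F : Fin 3 → AnalyticFunction (ℝ × Vec3)) (t : ℝ) (x : Vec3)

theorem deriv_mapField : deriv (fun s => mapField ℓ F (s, x)) t =
    mapField ℓ (fun i => timeDeriv (F i)) (t, x) := by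
  rw [deriv_prodMk_left ((contDiff_mapField ℓ F).differentiable (by simp) _),
    fderiv_mapField_apply]

theorem pderiv_mapField_slice (j i : Fin 3) :
    pderiv (fun y => mapField ℓ F (t, y)) j i x = ℓ (spaceDeriv j (F i) (t, x)) := by
  rw [pderiv, fderiv_prodMk_right_apply ((contDiff_mapField ℓ F).differentiable (by simp) _),
    fderiv_mapField_apply, mapField]

theorem divergence_mapField_slice :
    divergence (fun y => mapField ℓ F (t, y)) x = ℓ (div spaceDeriv F (t, x)) := by
  simp [divergence, pderiv_mapField_slice, div]

theorem curl_mapField_slice :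
    curl (fun y => mapField ℓ F (t, y)) x = mapField ℓ (rot spaceDeriv F) (t, x) := by
  ext i
  simp [curl_apply, pderiv_mapField_slice, rot, mapField]

end RealAndImaginaryParts

section RiemannSilbersteinMaxwell

open Complex

variable {F : Fin 3 → AnalyticFunction (ℝ × Vec3)} {E B : ℝ → Vec3 → Vec3}

theorem IsRiemannSilberstein.isMaxwellSolution (h : IsRiemannSilberstein timeDeriv spaceDeriv F) :
    IsMaxwellSolution (fun t x => mapField reCLM F (t, x)) fun t x => mapField imCLM F (t, x) where
  contDiff_E := (contDiff_mapField reCLM F).of_le le_top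
  contDiff_B := (contDiff_mapField imCLM F).of_le le_top
  ampere t x := by
    ext i
    simp [deriv_mapField, curl_mapField_slice, h.evolution, mapField]
  faraday t x := by
    ext i
    simp [deriv_mapField, curl_mapField_slice, h.evolution, mapField]
  gauss_E t x := by simp [divergence_mapField_slice, h.div_eq_zero]
  gauss_B t x := by simp [divergence_mapField_slice, h.div_eq_zero]

theorem IsRiemannSilberstein.eq_zero (h : IsRiemannSilberstein timeDeriv spaceDeriv F)
    (h₀ : ∀ i x, F i (0, x) = 0) : F = 0 := by
  obtain ⟨hre, him⟩ := h.isMaxwellSolution.eq_zero (by ext; simp [mapField, h₀])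
    (by ext; simp [mapField, h₀])
  ext i ⟨t, x⟩
  exact Complex.ext congr($hre t x i) congr($him t x i)

theorem IsMaxwellSolution.exists_eq_mapField (h : IsMaxwellSolution E B)
    (hE : AnalyticOnNhd ℝ (E 0) univ) (hB : AnalyticOnNhd ℝ (B 0) univ) :
    ∃ F : Fin 3 → AnalyticFunction (ℝ × Vec3), IsRiemannSilberstein timeDeriv spaceDeriv F ∧
      (E = fun t x => mapField reCLM F (t, x)) ∧ B = fun t x => mapField imCLM F (t, x) := by
  let f (i : Fin 3) : AnalyticFunction Vec3 := ⟨fun x => ⟨E 0 x i, B 0 x i⟩,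
    equivRealProdCLM.symm.contDiff.comp
      ((contDiff_pi.1 (contDiff_omega_iff_analyticOnNhd.2 hE) i).prodMk
        (contDiff_pi.1 (contDiff_omega_iff_analyticOnNhd.2 hB) i))⟩
  have hdiv : div partialDeriv f = 0 := by
    ext x
    refine Complex.ext ?_ ?_
    · exact (divergence_mapField reCLM f x).symm.trans (h.gauss_E 0 x)
    · exact (divergence_mapField imCLM f x).symm.trans (h.gauss_B 0 x)
  obtain ⟨F, hF, hF₀⟩ := exists_isRiemannSilberstein hdiv
  refine ⟨F, hF, h.ext hF.isMaxwellSolution ?_ ?_⟩ <;> ext x i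
  · exact congr(re $(hF₀ i x)).symm
  · exact congr(im $(hF₀ i x)).symm

end RiemannSilbersteinMaxwell

section NullPropagation

open Complex

variable {F : Fin 3 → AnalyticFunction (ℝ × Vec3)}

theorem IsRiemannSilberstein.complexSq_eq_zero (h : IsRiemannSilberstein timeDeriv spaceDeriv F)
    (h₀ : ∀ x, complexSq F (0, x) = 0) (h₁ : ∀ x, timeDeriv (complexSq F) (0, x) = 0) :
    complexSq F = 0 := by
  by_cases hF : ∀ k x, F k (0, x) = 0
  · simp [complexSq, h.eq_zero hF]
  push Not at hF
  obtain ⟨k, hk⟩ := hF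
  have hopen : IsOpen {x | F k (0, x) ≠ 0} :=
    isOpen_ne_fun ((contDiff_coe (F k)).continuous.comp (.prodMk_right 0)) continuous_const
  refine eq_zero_of_mem_contactIdeal hopen hk <|
    mem_contactIdeal_of_mul_box_mem (a := F k ^ 2) (fun _ _ => dirDeriv_comm _ _ _)
      (fun _ _ => dirDeriv_space_mem_vanishingOn hopen _) ?_
      (h.sq_mul_box_complexSq_mem (fun _ _ => dirDeriv_comm _ _) (fun _ => dirDeriv_comm _ _) k)
      ?_ ?_
  · rintro b hb ⟨_, x⟩ ⟨rfl, hx⟩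
    exact (mul_eq_zero.1 (hb (0, x) ⟨rfl, hx⟩)).resolve_left (pow_ne_zero 2 hx)
  · rintro ⟨_, x⟩ ⟨rfl, -⟩
    exact h₀ x
  · rintro ⟨_, x⟩ ⟨rfl, -⟩
    exact h₁ x

variable (F) in
theorem complexSq_apply_eq_zero_iff (p : ℝ × Vec3) :
    complexSq F p = 0 ↔ mapField reCLM F p ⬝ᵥ mapField imCLM F p = 0 ∧
      mapField reCLM F p ⬝ᵥ mapField reCLM F p = mapField imCLM F p ⬝ᵥ mapField imCLM F p := by
  rw [complexSq, AnalyticFunction.coe_sum, Finset.sum_apply]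
  simp only [AnalyticFunction.coe_mul, Pi.mul_apply, mapField, Fin.sum_univ_three,
    Matrix.vec3_dotProduct, Complex.ext_iff, Complex.add_re, Complex.add_im, Complex.mul_re,
    Complex.mul_im, Complex.zero_re, Complex.zero_im, reCLM_apply, imCLM_apply]
  constructor <;> rintro ⟨h, h'⟩ <;> constructor <;> linarith

theorem IsRiemannSilberstein.timeDeriv_complexSq_apply_eq_zero_iff
    (h : IsRiemannSilberstein timeDeriv spaceDeriv F) (t : ℝ) (x : Vec3) :
    timeDeriv (complexSq F) (t, x) = 0 ↔
      mapField reCLM F (t, x) ⬝ᵥ curl (fun y => mapField imCLM F (t, y)) x +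
        mapField imCLM F (t, x) ⬝ᵥ curl (fun y => mapField reCLM F (t, y)) x = 0 ∧
      mapField imCLM F (t, x) ⬝ᵥ curl (fun y => mapField imCLM F (t, y)) x -
        mapField reCLM F (t, x) ⬝ᵥ curl (fun y => mapField reCLM F (t, y)) x = 0 := by
  have hrot : timeDeriv (complexSq F) (t, x) = 0 ↔
      ∑ i, F i (t, x) * rot spaceDeriv F i (t, x) = 0 := by
    simp [h.dt_complexSq]
  simp only [hrot, curl_mapField_slice, Complex.ext_iff, mapField, Fin.sum_univ_three,
    Matrix.vec3_dotProduct, Complex.add_re, Complex.add_im, Complex.mul_re, Complex.mul_im,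
    Complex.zero_re, Complex.zero_im, reCLM_apply, imCLM_apply]
  constructor <;> rintro ⟨h, h'⟩ <;> constructor <;> linarith

end NullPropagation

section ShearFree

variable {X V E B : Vec3 → Vec3}

theorem sum_mul_pderiv_eq_dotProduct_fderiv (X : Vec3 → Vec3) (a b x : Vec3) :
    ∑ i, ∑ j, a i * b j * pderiv X j i x = a ⬝ᵥ fderiv ℝ X x b := by
  conv_rhs => rw [pi_eq_sum_univ' b, map_sum]
  simp only [dotProduct, Finset.sum_apply, map_smul, Pi.smul_apply, smul_eq_mul, Finset.mul_sum]
  exact Finset.sum_congr rfl fun i _ => Finset.sum_congr rfl fun j _ => mul_assoc _ _ _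

theorem crossProduct_dotProduct_curl (X : Vec3 → Vec3) (v w x : Vec3) :
    (v ⨯₃ w) ⬝ᵥ curl X x = w ⬝ᵥ fderiv ℝ X x v - v ⬝ᵥ fderiv ℝ X x w := by
  simp only [← sum_mul_pderiv_eq_dotProduct_fderiv]
  simp only [Fin.sum_univ_three, cross_apply, curl, Matrix.vec3_dotProduct, Matrix.cons_val]
  ring

theorem dotProduct_fderiv_eq_of_dotProduct_eq_zero (hX : Differentiable ℝ X)
    (hV : Differentiable ℝ V) (hVX : ∀ x, V x ⬝ᵥ X x = 0) (x w : Vec3) :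
    X x ⬝ᵥ fderiv ℝ V x w = (V x ⨯₃ w) ⬝ᵥ curl X x - w ⬝ᵥ fderiv ℝ X x (V x) := by
  have hderiv := fderiv_dotProduct_apply (hV x) (hX x) w
  simp only [hVX, fderiv_fun_const, Pi.zero_apply, zero_apply] at hderiv
  rw [crossProduct_dotProduct_curl, dotProduct_comm (X x)]
  linarith

namespace IsNull

theorem energyDensity_eq (h : IsNull E B) (x : Vec3) : energyDensity E B x = E x ⬝ᵥ E x := by
  rw [energyDensity, ← (h x).2, add_self_div_two]

theorem dotProduct_fderiv (h : IsNull E B) (hE : Differentiable ℝ E) (hB : Differentiable ℝ B)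
    (x v : Vec3) : E x ⬝ᵥ fderiv ℝ E x v = B x ⬝ᵥ fderiv ℝ B x v ∧
      E x ⬝ᵥ fderiv ℝ B x v + B x ⬝ᵥ fderiv ℝ E x v = 0 := by
  have hEE := fderiv_dotProduct_apply (hE x) (hE x) v
  have hBB := fderiv_dotProduct_apply (hB x) (hB x) v
  have hEB := fderiv_dotProduct_apply (hE x) (hB x) v
  simp only [(h _).1, (h _).2, hBB, fderiv_fun_const, Pi.zero_apply, zero_apply,
    dotProduct_comm (fderiv _ _ _ _)] at hEE hEB
  exact ⟨by linarith, hEB.symm⟩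

end IsNull

namespace IsNormalizedPoynting

theorem dotProduct_E_eq_zero (h : IsNormalizedPoynting E B V) (x : Vec3) : V x ⬝ᵥ E x = 0 := by
  obtain hW | hW := eq_or_ne (energyDensity E B x) 0
  · simp [(energyDensity_eq_zero_iff.1 hW).1]
  · refine (mul_eq_zero.1 ?_).resolve_left hW
    rw [← smul_eq_mul, ← smul_dotProduct, h.energyDensity_smul, dotProduct_comm, dot_self_cross]

theorem dotProduct_B_eq_zero (h : IsNormalizedPoynting E B V) (x : Vec3) : V x ⬝ᵥ B x = 0 := by
  obtain hW | hW := eq_or_ne (energyDensity E B x) 0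
  · simp [(energyDensity_eq_zero_iff.1 hW).2]
  · refine (mul_eq_zero.1 ?_).resolve_left hW
    rw [← smul_eq_mul, ← smul_dotProduct, h.energyDensity_smul, dotProduct_comm, dot_cross_self]

theorem crossProduct_E (h : IsNormalizedPoynting E B V) (hnull : IsNull E B) (x : Vec3) :
    V x ⨯₃ E x = B x := by
  obtain hW | hW := eq_or_ne (energyDensity E B x) 0
  · simp [energyDensity_eq_zero_iff.1 hW]
  · refine smul_right_injective _ hW ?_
    change energyDensity E B x • (V x ⨯₃ E x) = energyDensity E B x • B x
    rw [← LinearMap.map_smul₂, h.energyDensity_smul, cross_cross_eq_smul_sub_smul,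
      dotProduct_comm (B x), (hnull x).1, zero_smul, sub_zero, hnull.energyDensity_eq]

theorem crossProduct_B (h : IsNormalizedPoynting E B V) (hnull : IsNull E B) (x : Vec3) :
    V x ⨯₃ B x = -E x := by
  obtain hW | hW := eq_or_ne (energyDensity E B x) 0
  · simp [energyDensity_eq_zero_iff.1 hW]
  · refine smul_right_injective _ hW ?_
    change energyDensity E B x • (V x ⨯₃ B x) = energyDensity E B x • -E x
    rw [← LinearMap.map_smul₂, h.energyDensity_smul, cross_cross_eq_smul_sub_smul, (hnull x).1,
      zero_smul, zero_sub, ← (hnull x).2, hnull.energyDensity_eq, smul_neg]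

end IsNormalizedPoynting

theorem IsNormalizedPoynting.isShearFree_iff (h : IsNormalizedPoynting E B V)
    (hE : Differentiable ℝ E) (hB : Differentiable ℝ B) (hnull : IsNull E B) :
    IsShearFree E B V ↔ ∀ x, E x ⬝ᵥ curl B x + B x ⬝ᵥ curl E x = 0 ∧
      B x ⬝ᵥ curl B x - E x ⬝ᵥ curl E x = 0 := by
  have hV := h.smooth.differentiable (by simp)
  refine forall_congr' fun x => ?_
  have hEV := dotProduct_fderiv_eq_of_dotProduct_eq_zero hE hV h.dotProduct_E_eq_zero x
  have hBV := dotProduct_fderiv_eq_of_dotProduct_eq_zero hB hV h.dotProduct_B_eq_zero x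
  obtain ⟨hsq, hmix⟩ := hnull.dotProduct_fderiv hE hB x (V x)
  have hBE : ∑ i, ∑ j, E x j * B x i * pderiv V j i x = B x ⬝ᵥ fderiv ℝ V x (E x) := by
    simp only [mul_comm (E x _), sum_mul_pderiv_eq_dotProduct_fderiv]
  simp only [sub_mul, add_mul, Finset.sum_sub_distrib, Finset.sum_add_distrib, hBE,
    sum_mul_pderiv_eq_dotProduct_fderiv]
  rw [hEV, hBV, hEV, hBV, h.crossProduct_E hnull, h.crossProduct_B hnull, neg_dotProduct,
    neg_dotProduct]
  constructor <;> rintro ⟨h, h'⟩ <;> constructor <;> linarith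

end ShearFree

end

end Maxwell

theorem mainTheorem1
    (E B : ℝ → Maxwell.Vec3 → Maxwell.Vec3)
    (E₀ B₀ V₀ : Maxwell.Vec3 → Maxwell.Vec3)
    (hEB : Maxwell.IsMaxwellSolution E B)
    (hE₀ : E 0 = E₀) (hB₀ : B 0 = B₀)
    (hE₀_analytic : AnalyticOnNhd ℝ E₀ Set.univ)
    (hB₀_analytic : AnalyticOnNhd ℝ B₀ Set.univ)
    (hV₀ : Maxwell.IsNormalizedPoynting E₀ B₀ V₀) :
    (∀ t, Maxwell.IsNull (E t) (B t)) ↔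
      ((∀ x, Maxwell.divergence E₀ x = 0 ∧ Maxwell.divergence B₀ x = 0) ∧
        Maxwell.IsNull E₀ B₀ ∧
        Maxwell.IsShearFree E₀ B₀ V₀) := by
  subst hE₀ hB₀
  have hshear := hV₀.isShearFree_iff ((hEB.contDiff_E_apply 0).differentiable one_ne_zero)
    ((hEB.contDiff_B_apply 0).differentiable one_ne_zero)
  obtain ⟨F, hF, rfl, rfl⟩ := hEB.exists_eq_mapField hE₀_analytic hB₀_analytic
  constructor
  · intro hnull
    have hF₀ : Maxwell.complexSq F = 0 :=
      Maxwell.AnalyticFunction.ext fun p =>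
        (Maxwell.complexSq_apply_eq_zero_iff F p).2 (hnull p.1 p.2)
    refine ⟨fun x => ⟨hEB.gauss_E 0 x, hEB.gauss_B 0 x⟩, hnull 0, (hshear (hnull 0)).2 fun x => ?_⟩
    exact (hF.timeDeriv_complexSq_apply_eq_zero_iff 0 x).1 (by simp [hF₀])
  · rintro ⟨-, hnull, hshearFree⟩ t x
    have hF₀ : Maxwell.complexSq F = 0 := hF.complexSq_eq_zero
      (fun x => (Maxwell.complexSq_apply_eq_zero_iff F (0, x)).2 (hnull x))
      fun x => (hF.timeDeriv_complexSq_apply_eq_zero_iff 0 x).2 ((hshear hnull).1 hshearFree x)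
    exact (Maxwell.complexSq_apply_eq_zero_iff F (t, x)).1 (by simp [hF₀])
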